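/- A quantum channel $\mathcal E$ from $\mathcal B(\mathcal H_A)$ to $\mathcal B(\mathcal H_B)$ (finite-dimensional complex spaces) is a map $\mathcal E(\rho)=\sum_i E_i\rho E_i^\dagger$ with $\sum_i E_i^\dagger E_i=I$, and $\mathcal K(\mathcal E)=\mathrm{span}\{E_i^\dagger E_j\}$. Let $\alpha(\mathcal E)$ be the maximal number of input states whose outputs under $\mathcal E$ can be perfectly distinguished by a measurement, and let $C^{(0)}(\mathcal E)=\sup_{k\ge1}\frac1k\log_2\alpha(\mathcal E^{\otimes k})$. Consider protocols in which Alice and Bob use $\mathcal E$ (from Alice to Bob) $n$ times; Alice may apply arbitrary quantum channels to her local system, Bob may apply quantum instruments to his local system and send the classical outcomes to Alice at any time, and they share no other resource. $C^{(0)}_{cfb}(\mathcal E)$ (respectively $Q^{(0)}_{cfb}(\mathcal E)$) is the supremum of $\frac1n\log_2 N$ over all $n\ge1$ and all $N$ such that some protocol of this kind with $n$ uses of $\mathcal E$ transmits $N$ classical messages (respectively every pure state of an $N$-dimensional quantum system) from Alice to Bob with zero error. (1) There is a quantum channel $\mathcal E$ from $\mathcal B(\mathbb C^2)$ to $\mathcal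 B(\mathbb C^2\otimes\mathbb C^4)$ with $\mathcal K(\mathcal E)=\mathrm{span}\{I,X,Y\}$, where $X,Y$ are Pauli matrices, such that $$C^{(0)}(\mathcal E)=0,\qquad C^{(0)}_{cfb}(\mathcal E)\ge\tfrac13,\qquad Q^{(0)}_{cfb}(\mathcal E)\ge\tfrac18 .$$ (2) For $N\ge1$, orthonormal bases $\{|\psi_{k0}\rangle,|\psi_{k1}\rangle\}$ of $\mathbb C^2$ and unitaries $U_k$ on $\mathbb C^2$ ($1\le k\le N$), let $\mathcal E$ be the channel from $\mathcal B(\mathbb C^2\otimes\mathbb C^2)$ to $\mathcal B(\mathbb C^N\otimes\mathbb C^2)$ with the Kraus operators $$\tfrac1{\sqrt N}\,|k\rangle\langle\psi_{k0}^*|\otimes I,\qquad \tfrac1{\sqrt N}\,|k\rangle\langle\psi_{k1}^*|\otimes U_k\qquad(1\le k\le N),$$ where $*$ denotes complex conjugation in the standard basis. The parameters can be chosen such that the Hilbert–Schmidt orthogonal complement of $\mathcal K(\mathcal E)$ is $\{I\otimes D:\ \mathrm{tr}\,D=0\}$, and for every such choice $$C^{(0)}(\mathcal E)=0,\qquad C^{(0)}_{cfb}(\mathcal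 E)\ \ge\ Q^{(0)}_{cfb}(\mathcal E)\ \ge\ \tfrac12 .$$ -/

import Mathlib

open scoped Kronecker ComplexOrder

noncomputable section

/-- A quantum channel from `B(ℂ^A)` to `B(ℂ^B)`, given by a finite family of Kraus operators
`E_i` with `∑ E_i† E_i = 1`. -/
structure QChannel (A B : Type) [Fintype A] [DecidableEq A] [Fintype B] [DecidableEq B] where
  ι : Type
  [fintypeι : Fintype ι]
  op : ι → Matrix B A ℂ
  complete : ∑ i, (op i).conjTranspose * op i = 1

attribute [instance] QChannel.fintypeι

namespace QChannel

variable {A B C D : Type}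
variable [Fintype A] [DecidableEq A] [Fintype B] [DecidableEq B]
variable [Fintype C] [DecidableEq C] [Fintype D] [DecidableEq D]

/-- The action `ρ ↦ ∑ E_i ρ E_i†`. -/
def apply (E : QChannel A B) (ρ : Matrix A A ℂ) : Matrix B B ℂ :=
  ∑ i, E.op i * ρ * (E.op i).conjTranspose

/-- The operator space `span {E_i† E_j}`. -/
def opSpace (E : QChannel A B) : Submodule ℂ (Matrix A A ℂ) :=
  Submodule.span ℂ {M | ∃ i j, M = (E.op i).conjTranspose * E.op j}

/-- The noiseless channel. -/
def ident (A : Type) [Fintype A] [DecidableEq A] : QChannel A A where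
  ι := Unit
  op := fun _ => 1
  complete := by simp

/-- Sequential composition: first `E`, then `F`. -/
def comp (F : QChannel B C) (E : QChannel A B) : QChannel A C where
  ι := E.ι × F.ι
  op := fun p => F.op p.2 * E.op p.1
  complete := by
    have h : ∀ i : E.ι, ∑ j : F.ι, (F.op j * E.op i).conjTranspose * (F.op j * E.op i)
        = (E.op i).conjTranspose * E.op i := by
      intro i
      calc ∑ j : F.ι, (F.op j * E.op i).conjTranspose * (F.op j * E.op i)
          = (E.op i).conjTranspose * (∑ j : F.ι, (F.op j).conjTranspose * F.op j) * E.op i := by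
            simp only [Matrix.mul_sum, Matrix.sum_mul, Matrix.conjTranspose_mul, Matrix.mul_assoc]
        _ = _ := by rw [F.complete, Matrix.mul_one]
    rw [Fintype.sum_prod_type]
    simp only [h, E.complete]

/-- Parallel composition. -/
def tensor (E : QChannel A B) (F : QChannel C D) : QChannel (A × C) (B × D) where
  ι := E.ι × F.ι
  op := fun p => E.op p.1 ⊗ₖ F.op p.2
  complete := by
    rw [Fintype.sum_prod_type]
    have h : ∀ (i : E.ι) (j : F.ι),
        (E.op i ⊗ₖ F.op j).conjTranspose * (E.op i ⊗ₖ F.op j)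
          = ((E.op i).conjTranspose * E.op i) ⊗ₖ ((F.op j).conjTranspose * F.op j) := by
      intro i j
      rw [Matrix.conjTranspose_kronecker, ← Matrix.mul_kronecker_mul]
    ext ⟨a, c⟩ ⟨a', c'⟩
    have hE := congrFun (congrFun E.complete a) a'
    have hF := congrFun (congrFun F.complete c) c'
    simp only [Matrix.sum_apply] at hE hF
    simp only [h, Matrix.sum_apply, Matrix.kroneckerMap_apply]
    rw [← Finset.sum_mul_sum, hE, hF]
    simp only [Matrix.one_apply, Prod.mk.injEq]
    split_ifs <;> simp_all

/-- Renaming the basis labels of the output system. -/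
def relabel (E : QChannel A B) (e : C ≃ B) : QChannel A C where
  ι := E.ι
  op := fun i => (E.op i).submatrix e id
  complete := by
    have h : ∀ i : E.ι, ((E.op i).submatrix e id).conjTranspose * (E.op i).submatrix e id
        = (E.op i).conjTranspose * E.op i := by
      intro i
      rw [Matrix.conjTranspose_submatrix, Matrix.submatrix_mul_equiv, Matrix.submatrix_id_id]
    simp only [h, E.complete]

/-- The `k`-fold tensor power, on the systems `(ℂ^A)^{⊗k} = ℂ^(Fin k → A)`. -/
def power (E : QChannel A B) (k : ℕ) : QChannel (Fin k → A) (Fin k → B) where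
  ι := Fin k → E.ι
  op := fun s => Matrix.of fun b a => ∏ i, E.op (s i) (b i) (a i)
  complete := by
    ext a a'
    simp only [Matrix.sum_apply, Matrix.mul_apply, Matrix.conjTranspose_apply, Matrix.of_apply,
      star_prod, ← Finset.prod_mul_distrib]
    have h1 : ∀ s : Fin k → E.ι,
        (∑ b : Fin k → B, ∏ i, star (E.op (s i) (b i) (a i)) * E.op (s i) (b i) (a' i))
          = ∏ i, ∑ y, star (E.op (s i) y (a i)) * E.op (s i) y (a' i) := by
      intro s
      exact (Fintype.prod_sum fun i y => star (E.op (s i) y (a i)) * E.op (s i) y (a' i)).symm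
    simp only [h1]
    rw [← Fintype.prod_sum fun (i : Fin k) (t : E.ι) =>
      ∑ y, star (E.op t y (a i)) * E.op t y (a' i)]
    have h2 : ∀ i : Fin k, (∑ t : E.ι, ∑ y, star (E.op t y (a i)) * E.op t y (a' i))
        = (1 : Matrix A A ℂ) (a i) (a' i) := by
      intro i
      rw [← E.complete]
      simp [Matrix.sum_apply, Matrix.mul_apply]
    simp only [h2, Matrix.one_apply, Finset.prod_ite_zero, Finset.prod_const_one]
    simp [funext_iff]

/-- The partial trace over the first system. -/
def discardFst (A B : Type) [Fintype A] [DecidableEq A] [Fintype B] [DecidableEq B] :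
    QChannel (A × B) B where
  ι := A
  op := fun a => Matrix.of fun b p => if p = (a, b) then 1 else 0
  complete := by
    ext ⟨a, b⟩ ⟨a', b'⟩
    simp only [Matrix.sum_apply, Matrix.mul_apply, Matrix.conjTranspose_apply, Matrix.of_apply,
      Matrix.one_apply, Prod.mk.injEq]
    by_cases ha : a = a' <;> by_cases hb : b = b' <;> simp_all [ite_and, Finset.sum_ite_eq]

/-- A quantum instrument, recorded as a channel: every Kraus operator `K_i` carries a classical
outcome `out i`, which is written into an additional system,
`ρ ↦ ∑_i |out i⟩⟨out i| ⊗ K_i ρ K_i†`. -/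
def record {J : Type} [Fintype J] [DecidableEq J] (E : QChannel A B) (out : E.ι → J) :
    QChannel A (J × B) where
  ι := E.ι
  op := fun i => Matrix.of fun p a => if p.1 = out i then E.op i p.2 a else 0
  complete := by
    rw [← E.complete]
    refine Finset.sum_congr rfl fun i _ => ?_
    ext a a'
    simp [Matrix.mul_apply, Fintype.sum_prod_type]

end QChannel

/-- Density matrices. -/
def IsState {A : Type} [Fintype A] (ρ : Matrix A A ℂ) : Prop :=
  ρ.PosSemidef ∧ ρ.trace = 1

section OneShot

variable {A B : Type} [Fintype A] [DecidableEq A] [Fintype B] [DecidableEq B]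

/-- There are `N` input states whose outputs are perfectly distinguished by some measurement
(POVM). The maximal such `N` is the quantum clique number `α(E)`. -/
def SendsClassical (E : QChannel A B) (N : ℕ) : Prop :=
  ∃ (ρ : Fin N → Matrix A A ℂ) (P : Fin N → Matrix B B ℂ),
    (∀ i, IsState (ρ i)) ∧ (∀ j, (P j).PosSemidef) ∧ ∑ j, P j = 1 ∧
      ∀ i j, (P j * E.apply (ρ i)).trace = if i = j then 1 else 0

/-- There is an `N`-dimensional subspace of the input space, given as the range of an isometry
`V : ℂ^N → ℂ^A`, and a recovery channel `R` which restores every pure state of that subspace.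
The maximal such `N` is `α^q(E)`. -/
def SendsQuantum (E : QChannel A B) (N : ℕ) : Prop :=
  ∃ (V : Matrix A (Fin N) ℂ) (R : QChannel B (Fin N)),
    V.conjTranspose * V = 1 ∧
      ∀ φ : Fin N → ℂ,
        R.apply (E.apply (V * Matrix.vecMulVec φ (star φ) * V.conjTranspose))
          = Matrix.vecMulVec φ (star φ)

/-- The zero-error classical capacity `sup_{k ≥ 1} log₂ α(E^{⊗k}) / k`, as an extended real. -/
def zeroErrorC (E : QChannel A B) : EReal :=
  ⨆ (k : ℕ) (_ : 1 ≤ k) (N : ℕ) (_ : SendsClassical (E.power k) N),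
    ((Real.logb 2 N / k : ℝ) : EReal)

end OneShot

/-- `CfbProtocol E R n A B T`: the channel `T` describes the joint evolution of Alice and Bob in
a protocol which uses the channel `E` from Alice to Bob exactly `n` times and in which Bob may send
classical messages to Alice. At the start Alice holds the system `R`, at this point Alice holds
the system `A` and Bob the system `B`. -/
inductive CfbProtocol {X Y : Type} [Fintype X] [DecidableEq X] [Fintype Y] [DecidableEq Y]
    (E : QChannel X Y) (R : Type) [Fintype R] [DecidableEq R] :
    ℕ → (A B : Type) → [Fintype A] → [DecidableEq A] → [Fintype B] → [DecidableEq B] →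
      QChannel R (A × B) → Prop
  /-- At the start Alice holds `R` and Bob holds nothing. -/
  | start : CfbProtocol E R 0 R Unit ((QChannel.ident R).relabel (Equiv.prodPUnit R))
  /-- Alice applies a quantum channel to her system. -/
  | alice {n : ℕ} {A A' B : Type} [Fintype A] [DecidableEq A] [Fintype A'] [DecidableEq A']
      [Fintype B] [DecidableEq B] {T : QChannel R (A × B)} (F : QChannel A A') :
      CfbProtocol E R n A B T →
      CfbProtocol E R n A' B ((F.tensor (QChannel.ident B)).comp T)
  /-- Bob applies a quantum instrument to his system and sends the outcome in `J` to Alice. -/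
  | bob {n : ℕ} {A B B' J : Type} [Fintype A] [DecidableEq A] [Fintype B] [DecidableEq B]
      [Fintype B'] [DecidableEq B'] [Fintype J] [DecidableEq J] {T : QChannel R (A × B)}
      (F : QChannel B B') (out : F.ι → J) :
      CfbProtocol E R n A B T →
      CfbProtocol E R n (A × J) B'
        ((((QChannel.ident A).tensor (F.record out)).relabel (Equiv.prodAssoc A J B')).comp T)
  /-- Alice sends the part `X` of her system to Bob through `E`. -/
  | send {n : ℕ} {A B : Type} [Fintype A] [DecidableEq A] [Fintype B] [DecidableEq B]
      {T : QChannel R ((A × X) × B)} :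
      CfbProtocol E R n (A × X) B T →
      CfbProtocol E R (n + 1) A (Y × B)
        (((((QChannel.ident A).tensor E).tensor (QChannel.ident B)).relabel
          (Equiv.prodAssoc A Y B).symm).comp T)

section Feedback

variable {X Y : Type} [Fintype X] [DecidableEq X] [Fintype Y] [DecidableEq Y]

/-- The channel `T` from `R` (Alice) to `B` (Bob) can be realized by `n` uses of `E` and classical
feedback. At the end Alice's system is discarded. -/
def CfbRealizes (E : QChannel X Y) (n : ℕ) {R B : Type} [Fintype R] [DecidableEq R]
    [Fintype B] [DecidableEq B] (T : QChannel R B) : Prop :=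
  ∃ (A : Type) (_ : Fintype A) (_ : DecidableEq A) (S : QChannel R (A × B)),
    CfbProtocol E R n A B S ∧ T = (QChannel.discardFst A B).comp S

/-- `N` classical messages can be sent without error by `n` uses of `E` and classical feedback. -/
def CfbSendsClassical (E : QChannel X Y) (n N : ℕ) : Prop :=
  ∃ (R B : Type) (_ : Fintype R) (_ : DecidableEq R) (_ : Fintype B) (_ : DecidableEq B)
    (T : QChannel R B), CfbRealizes E n T ∧ SendsClassical T N

/-- An `N`-dimensional quantum system can be sent without error by `n` uses of `E` and classical
feedback. -/
def CfbSendsQuantum (E : QChannel X Y) (n N : ℕ) : Prop :=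
  ∃ (R B : Type) (_ : Fintype R) (_ : DecidableEq R) (_ : Fintype B) (_ : DecidableEq B)
    (T : QChannel R B), CfbRealizes E n T ∧ SendsQuantum T N

/-- The zero-error classical capacity assisted by classical feedback. -/
def zeroErrorCcfb (E : QChannel X Y) : EReal :=
  ⨆ (n : ℕ) (_ : 1 ≤ n) (N : ℕ) (_ : CfbSendsClassical E n N), ((Real.logb 2 N / n : ℝ) : EReal)

/-- The zero-error quantum capacity assisted by classical feedback. -/
def zeroErrorQcfb (E : QChannel X Y) : EReal :=
  ⨆ (n : ℕ) (_ : 1 ≤ n) (N : ℕ) (_ : CfbSendsQuantum E n N), ((Real.logb 2 N / n : ℝ) : EReal)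

end Feedback

/-- The Pauli matrix `X`. -/
def pauliX : Matrix (Fin 2) (Fin 2) ℂ := !![0, 1; 1, 0]

/-- The Pauli matrix `Y`. -/
def pauliY : Matrix (Fin 2) (Fin 2) ℂ := !![0, -Complex.I; Complex.I, 0]

/-- The Hilbert-Schmidt orthogonal complement `{M | tr (K† M) = 0 for all K ∈ S}`. -/
def hsPerp {A : Type} [Fintype A] (S : Submodule ℂ (Matrix A A ℂ)) : Set (Matrix A A ℂ) :=
  {M | ∀ K ∈ S, (K.conjTranspose * M).trace = 0}

/-- The channel with a control qubit and a `d`-dimensional data system that, for a uniformly random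
`k`, measures the control qubit in the complex conjugate of the orthonormal basis `ψ k`, applies
`U k` to the data if the outcome is `1` and nothing if it is `0`, and outputs `k` and the data.
Its Kraus operators are `(1/√N) |k⟩⟨ψ_{k0}^*| ⊗ 1` and `(1/√N) |k⟩⟨ψ_{k1}^*| ⊗ U_k`; the row
vector `⟨ψ^*|` has the entries of `ψ`. -/
def controlledChannel (N d : ℕ) [NeZero N]
    (ψ : Fin N → OrthonormalBasis (Fin 2) ℂ (EuclideanSpace ℂ (Fin 2)))
    (U : Fin N → Matrix.unitaryGroup (Fin d) ℂ) :
    QChannel (Fin 2 × Fin d) (Fin N × Fin d) where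
  ι := Fin N × Fin 2
  op := fun p => ((1 / Real.sqrt N : ℝ) : ℂ) •
    (Matrix.vecMulVec (Pi.single p.1 1) (fun a => ψ p.1 p.2 a) ⊗ₖ
      (if p.2 = 0 then (1 : Matrix (Fin d) (Fin d) ℂ) else (U p.1 : Matrix (Fin d) (Fin d) ℂ)))
  complete := by
    have hN : ((N : ℕ) : ℂ) ≠ 0 := by exact_mod_cast NeZero.ne N
    have hs : (((1 / Real.sqrt N : ℝ) : ℂ)) * ((1 / Real.sqrt N : ℝ) : ℂ) = 1 / (N : ℂ) := by
      rw [← Complex.ofReal_mul, div_mul_div_comm, Real.mul_self_sqrt (Nat.cast_nonneg N)]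
      simp
    have hstar : star ((1 / Real.sqrt N : ℝ) : ℂ) = ((1 / Real.sqrt N : ℝ) : ℂ) :=
      Complex.conj_ofReal _
    have hU : ∀ (k : Fin N) (j : Fin 2),
        (if j = 0 then (1 : Matrix (Fin d) (Fin d) ℂ) else (U k : Matrix _ _ ℂ)).conjTranspose *
          (if j = 0 then (1 : Matrix (Fin d) (Fin d) ℂ) else (U k : Matrix _ _ ℂ)) = 1 := by
      intro k j
      by_cases hj : j = 0
      · simp [hj]
      · simp only [hj, if_false]
        exact Matrix.UnitaryGroup.star_mul_self (U k)
    have hv : ∀ (k : Fin N) (v : Fin 2 → ℂ),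
        (Matrix.vecMulVec (Pi.single k (1 : ℂ)) v).conjTranspose *
          Matrix.vecMulVec (Pi.single k (1 : ℂ)) v = Matrix.vecMulVec (star v) v := by
      intro k v
      ext a a'
      simp [Matrix.mul_apply, Matrix.vecMulVec_apply, Pi.single_apply]
    have hψ : ∀ (k : Fin N) (a a' : Fin 2), ∑ j, star (ψ k j a) * ψ k j a'
        = if a = a' then (1 : ℂ) else 0 := by
      intro k a a'
      have h := (ψ k).sum_inner_mul_inner (EuclideanSpace.single a' (1 : ℂ))
        (EuclideanSpace.single a (1 : ℂ))
      simp only [EuclideanSpace.inner_single_left, EuclideanSpace.inner_single_right] at h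
      simp only [map_one, one_mul] at h
      rw [← Finset.sum_congr rfl fun j _ => mul_comm (ψ k j a') (star (ψ k j a))]
      simpa [eq_comm] using h
    rw [Fintype.sum_prod_type]
    simp only [Matrix.conjTranspose_smul, Matrix.smul_mul, Matrix.mul_smul, smul_smul, hstar, hs,
      Matrix.conjTranspose_kronecker, ← Matrix.mul_kronecker_mul, hU, hv]
    ext ⟨a, b⟩ ⟨a', b'⟩
    simp only [Matrix.sum_apply, Matrix.smul_apply, Matrix.kroneckerMap_apply,
      Matrix.vecMulVec_apply, Pi.star_apply, smul_eq_mul, ← Finset.mul_sum, ← Finset.sum_mul, hψ]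
    simp [Matrix.one_apply, Prod.mk.injEq, hN]
    split_ifs <;> simp_all

end

/-! Vanishing of the unassisted capacity. If two inputs to `k` parallel uses have perfectly
distinguishable outputs, there are nonzero vectors `s, t` with `⟨s| K |t⟩ = 0` for all `K` in the
`k`-th tensor power of the operator space. Suppose that space contains `x (L x)ᵀ` for every `x`,
with `L` linear and invertible. Taking tensor products of such operators shows that the multilinear
forms given by `s` at `x` and by `t` at `L x` have product zero. Multilinear forms have no zero
divisors, so `s` or `t` vanishes (`zeroErrorC_eq_zero`). For `span {1, X, Y}`, the matrices with
equal diagonal entries, `L` swaps the two coordinates. For the second channel, `L` takes a vector,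
read as a two by two matrix, to its cofactor matrix.

Feedback protocols. Zero-error transmission depends on Kraus operators only up to scalars, so
`CfbReaches` follows protocols modulo scalars; normalization is restored by completeness. A family
of isometries with mutually orthogonal ranges can be reversed without knowing which one occurred
(`QChannel.recovery`), and all decoding is of this kind.

For the filter channel, two uses on halves of entangled pairs leave two copies of a partially
entangled state. Since `2 * a ^ 4 = 1`, the largest squared Schmidt coefficient of the two copies
together is `1/2`, so Bob can concentrate them deterministically into one maximally entangled pair;
feedback tells Alice his outcome. A phase flip on that pair survives the third use, because `Z` is
orthogonal to the operator space. The result is a coherent copy of a bit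
(`CfbReaches.coherentCopy`): one classical message bit, and, done in two complementary bases, one
qubit in six uses.

For the controlled channel, a first use on entangled halves followed by feedback of `k` gives a
maximally entangled pair. Half of it serves as the control in the second use, with the message as
data. Bob's half then shows which unitary acted, and he undoes it. -/

/-! ### Positive factorization and products of multilinear forms -/

open scoped MatrixOrder in
theorem Matrix.PosSemidef.exists_conjTranspose_mul_self {A : Type*} [Fintype A]
    {M : Matrix A A ℂ} (hM : M.PosSemidef) : ∃ S : Matrix A A ℂ, M = S.conjTranspose * S := by
  classical
  obtain ⟨S, hS⟩ := CStarAlgebra.nonneg_iff_eq_star_mul_self.mp hM.nonneg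
  exact ⟨S, hS⟩

/-- A vanishing product of two multilinear forms on powers of a space has a vanishing factor. -/
theorem MultilinearMap.eq_zero_or_eq_zero_of_mul_eq_zero {V : Type*} [AddCommGroup V] [Module ℂ V]
    (k : ℕ) (f g : MultilinearMap ℂ (fun _ : Fin k => V) ℂ) (h : ∀ x, f x * g x = 0) :
    f = 0 ∨ g = 0 := by
  induction k with
  | zero =>
    rcases mul_eq_zero.1 (h 0) with h0 | h0
    · left; ext x; rw [Subsingleton.elim x 0, h0]; rfl
    · right; ext x; rw [Subsingleton.elim x 0, h0]; rfl
  | succ k ih =>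
    -- The kernels of the two curried maps cover `V`, and a vector space is not the union of two
    -- proper subspaces.
    have key : ∀ v, f.curryLeft v = 0 ∨ g.curryLeft v = 0 := fun v =>
      ih _ _ fun x => by simpa using h (Fin.cons v x)
    by_cases hf : ∀ v, f.curryLeft v = 0
    · left
      ext x
      have := congrArg (fun F => F (Fin.tail x)) (hf (x 0))
      simpa using this
    · right
      push Not at hf
      obtain ⟨v, hv⟩ := hf
      have hg : ∀ w, g.curryLeft w = 0 := by
        intro w
        by_contra hw
        have hfw := (key w).resolve_right hw
        have hgv := (key v).resolve_left hv
        rcases key (v + w) with h1 | h1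
        · rw [map_add, hfw, add_zero] at h1; exact hv h1
        · rw [map_add, hgv, zero_add] at h1; exact hw h1
      ext x
      have := congrArg (fun F => F (Fin.tail x)) (hg (x 0))
      simpa using this

/-! ### Vanishing of the unassisted zero-error capacity -/

section ZeroCapacity

variable {A B : Type} [Fintype A] [DecidableEq A] [Fintype B] [DecidableEq B]

theorem SendsClassical.one (E : QChannel A B) (a : A) : SendsClassical E 1 := by
  refine ⟨fun _ => Matrix.vecMulVec (Pi.single a 1) (star (Pi.single a 1)), fun _ => 1,
    fun _ => ⟨Matrix.posSemidef_vecMulVec_self_star _, ?_⟩, fun _ => .one, by simp, ?_⟩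
  · simp [Matrix.trace_vecMulVec]
  · intro i j
    rw [if_pos (Subsingleton.elim i j), Matrix.one_mul, QChannel.apply, Matrix.trace_sum]
    simp_rw [Matrix.trace_mul_comm _ (Matrix.conjTranspose _), ← Matrix.mul_assoc]
    rw [← Matrix.trace_sum, ← Matrix.sum_mul, E.complete]
    simp [Matrix.trace_vecMulVec]

-- With `P = Q† Q` the trace is the squared Hilbert–Schmidt norm of `Q M`.
omit [DecidableEq A] [DecidableEq B] in
theorem Matrix.PosSemidef.mul_eq_zero_of_trace_eq_zero {P : Matrix B B ℂ} (hP : P.PosSemidef)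
    {M : Matrix B A ℂ} (h : (P * (M * M.conjTranspose)).trace = 0) : P * M = 0 := by
  obtain ⟨Q, rfl⟩ := hP.exists_conjTranspose_mul_self
  have h0 : (Q * M) * (Q * M).conjTranspose = Q * (M * M.conjTranspose) * Q.conjTranspose := by
    simp only [Matrix.conjTranspose_mul, Matrix.mul_assoc]
  have h1 : Q * M = 0 := by
    rw [← Matrix.trace_mul_conjTranspose_self_eq_zero_iff, h0, Matrix.trace_mul_comm,
      ← Matrix.mul_assoc, h]
  rw [Matrix.mul_assoc, h1, Matrix.mul_zero]

theorem Matrix.PosSemidef.mul_kraus_eq_zero (E : QChannel A B) {P : Matrix B B ℂ}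
    (hP : P.PosSemidef) {S : Matrix A A ℂ}
    (h : (P * E.apply (S * S.conjTranspose)).trace = 0) (i : E.ι) : P * (E.op i * S) = 0 := by
  have hterm : ∀ i, P * (E.op i * (S * S.conjTranspose) * (E.op i).conjTranspose) =
      P * ((E.op i * S) * (E.op i * S).conjTranspose) := fun i => by
    simp only [Matrix.conjTranspose_mul, Matrix.mul_assoc]
  apply hP.mul_eq_zero_of_trace_eq_zero
  rw [QChannel.apply, Matrix.mul_sum, Matrix.trace_sum] at h
  simp_rw [hterm] at h
  refine (Finset.sum_eq_zero_iff_of_nonneg fun j _ => ?_).1 h i (Finset.mem_univ i)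
  obtain ⟨Q, rfl⟩ := hP.exists_conjTranspose_mul_self
  rw [Matrix.mul_assoc, Matrix.trace_mul_comm, ← Matrix.mul_assoc, Matrix.mul_assoc,
    ← Matrix.conjTranspose_mul]
  exact (Matrix.posSemidef_self_mul_conjTranspose _).trace_nonneg

/-- Two perfectly distinguishable outputs yield a pair of input vectors which is orthogonal to
the operator space. -/
theorem SendsClassical.exists_orthogonal {E : QChannel A B} {N : ℕ} (h : SendsClassical E N)
    (hN : 2 ≤ N) : ∃ s t : A → ℂ, s ≠ 0 ∧ t ≠ 0 ∧
      ∀ i j, star s ⬝ᵥ ((E.op i).conjTranspose * E.op j).mulVec t = 0 := by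
  obtain ⟨ρ, P, hρ, hP, hsum, htr⟩ := h
  have factor : ∀ m, ∃ S : Matrix A A ℂ, ρ m = S * S.conjTranspose ∧ ∃ a, S.col a ≠ 0 := by
    intro m
    obtain ⟨S, hS⟩ := (hρ m).1.exists_conjTranspose_mul_self
    refine ⟨S.conjTranspose, by simpa using hS, ?_⟩
    by_contra! h0
    have : S.conjTranspose = 0 := by
      ext x y
      exact congrFun (h0 y) x
    have h1 := (hρ m).2
    rw [hS, this] at h1
    simp at h1
  let u : Fin N := ⟨0, by omega⟩
  let v : Fin N := ⟨1, by omega⟩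
  have huv : u ≠ v := by simp [u, v]
  obtain ⟨S, hS, a, ha⟩ := factor u
  obtain ⟨T, hT, b, hb⟩ := factor v
  refine ⟨S.col a, T.col b, ha, hb, fun i j => ?_⟩
  have hSz : P v * (E.op i * S) = 0 :=
    (hP v).mul_kraus_eq_zero E (by rw [← hS, htr, if_neg huv]) i
  have hTz : ∀ m, m ≠ v → P m * (E.op j * T) = 0 := fun m hm =>
    (hP m).mul_kraus_eq_zero E (by rw [← hT, htr, if_neg hm.symm]) j
  -- The other effects annihilate this output, so `P v` fixes it, while `P v` annihilates the output
  -- of `S`; hence the two are orthogonal.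
  have hTv : E.op j * T = P v * (E.op j * T) := by
    conv_lhs => rw [← Matrix.one_mul (E.op j * T), ← hsum, Matrix.sum_mul]
    exact Finset.sum_eq_single v (fun m _ hm => hTz m hm) (by simp)
  have hzero : (E.op i * S).conjTranspose * (E.op j * T) = 0 := by
    rw [hTv, ← (hP v).isHermitian.eq, ← Matrix.mul_assoc, ← Matrix.conjTranspose_mul, hSz]
    simp
  have := congrFun (congrFun hzero a) b
  rw [Matrix.conjTranspose_mul, Matrix.mul_assoc, ← Matrix.mul_assoc _ (E.op j),
    Matrix.mul_apply] at this
  simpa [dotProduct, Matrix.mulVec, Matrix.mul_apply] using this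

/-- The form `x ↦ ∑ s a ∏ (x i) (a i)`. -/
noncomputable def tensorForm {k : ℕ} (s : (Fin k → A) → ℂ) :
    MultilinearMap ℂ (fun _ : Fin k => A → ℂ) ℂ :=
  ∑ a, s a • (MultilinearMap.mkPiRing ℂ (Fin k) (1 : ℂ)).compLinearMap fun i => LinearMap.proj (a i)

omit [DecidableEq A] in
theorem tensorForm_apply {k : ℕ} (s : (Fin k → A) → ℂ) (x : Fin k → A → ℂ) :
    tensorForm s x = ∑ a, s a * ∏ i, x i (a i) := by
  simp [tensorForm]

theorem tensorForm_eq_zero {k : ℕ} {s : (Fin k → A) → ℂ} (h : tensorForm s = 0) : s = 0 := by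
  funext a
  have := congrArg (fun F => F fun i => Pi.single (a i) 1) h
  simp only [tensorForm_apply, zero_apply] at this
  rw [Finset.sum_eq_single a] at this
  · simpa using this
  · intro b _ hb
    obtain ⟨i, hi⟩ := Function.ne_iff.1 hb
    rw [Finset.prod_eq_zero (Finset.mem_univ i) (by simp [hi]), mul_zero]
  · simp

/-- If the operator space contains the rank one operators `x (L x)ᵀ` for an invertible linear `L`,
then no number of parallel uses can transmit a bit without error. -/
theorem zeroErrorC_eq_zero [Nonempty A] (E : QChannel A B) (L : (A → ℂ) ≃ₗ[ℂ] (A → ℂ))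
    (hL : ∀ x, Matrix.vecMulVec x (L x) ∈ E.opSpace) : zeroErrorC E = 0 := by
  apply le_antisymm
  · refine iSup_le fun k => iSup_le fun _ => iSup_le fun N => iSup_le fun hN => ?_
    have hN1 : N ≤ 1 := by
      by_contra! h2
      obtain ⟨s, t, hs, ht, hst⟩ := hN.exists_orthogonal h2
      let K : E.ι × E.ι → Matrix A A ℂ := fun p => (E.op p.1).conjTranspose * E.op p.2
      have hspan : ∀ x, ∃ c : E.ι × E.ι → ℂ, ∑ p, c p • K p = Matrix.vecMulVec x (L x) := by
        intro x
        rw [← Submodule.mem_span_range_iff_exists_fun]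
        refine Submodule.span_mono ?_ (hL x)
        rintro M ⟨i, j, rfl⟩
        exact ⟨(i, j), rfl⟩
      choose c hc using hspan
      have hK : ∀ f : Fin k → E.ι × E.ι,
          ∑ a, ∑ a', star (s a) * t a' * ∏ i, K (f i) (a i) (a' i) = 0 := by
        intro f
        have h0 := hst (fun i => (f i).1) (fun i => (f i).2)
        rw [← h0]
        simp only [dotProduct, Matrix.mulVec, Finset.mul_sum]
        refine Finset.sum_congr rfl fun a _ => Finset.sum_congr rfl fun a' _ => ?_
        simp only [QChannel.power, Matrix.mul_apply, Matrix.conjTranspose_apply, Matrix.of_apply,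
          star_prod, ← Finset.prod_mul_distrib, K, Pi.star_apply]
        rw [Fintype.prod_sum]
        ring
      -- The left side is `⟨s| ⨂ x_i (L x_i)ᵀ |t⟩`; expanding each factor in the operators `K p`
      -- reduces it to `hK`.
      have hprod : ∀ x : Fin k → A → ℂ, tensorForm (star s) x *
          (tensorForm t).compLinearMap (fun _ => (L : (A → ℂ) →ₗ[ℂ] (A → ℂ))) x = 0 := by
        intro x
        rw [MultilinearMap.compLinearMap_apply, tensorForm_apply, tensorForm_apply,
          Finset.sum_mul_sum]
        have hentry : ∀ a a' : Fin k → A, (∏ i, x i (a i)) * ∏ i, L (x i) (a' i) =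
            ∑ f : Fin k → E.ι × E.ι, (∏ i, c (x i) (f i)) * ∏ i, K (f i) (a i) (a' i) := by
          intro a a'
          simp only [← Finset.prod_mul_distrib]
          rw [← Fintype.prod_sum fun (i : Fin k) p => c (x i) p * K p (a i) (a' i)]
          refine Finset.prod_congr rfl fun i _ => ?_
          have := congrFun (congrFun (hc (x i)) (a i)) (a' i)
          simpa [Matrix.sum_apply, Matrix.vecMulVec_apply] using this.symm
        calc _ = ∑ a, ∑ a', ∑ f : Fin k → E.ι × E.ι, (∏ i, c (x i) (f i)) *
              (star (s a) * t a' * ∏ i, K (f i) (a i) (a' i)) := by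
              refine Finset.sum_congr rfl fun a _ => Finset.sum_congr rfl fun a' _ => ?_
              simp only [LinearEquiv.coe_coe, Pi.star_apply]
              rw [mul_mul_mul_comm, hentry, Finset.mul_sum]
              exact Finset.sum_congr rfl fun f _ => by ring
          _ = ∑ f : Fin k → E.ι × E.ι, (∏ i, c (x i) (f i)) *
              ∑ a, ∑ a', (star (s a) * t a' * ∏ i, K (f i) (a i) (a' i)) := by
              simp only [Finset.mul_sum]
              exact (Finset.sum_congr rfl fun a _ => Finset.sum_comm).trans Finset.sum_comm
          _ = 0 := Finset.sum_eq_zero fun f _ => by rw [hK f, mul_zero]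
      rcases MultilinearMap.eq_zero_or_eq_zero_of_mul_eq_zero k _ _ hprod with h | h
      · exact hs (star_eq_zero.1 (tensorForm_eq_zero h))
      · refine ht (tensorForm_eq_zero ?_)
        refine MultilinearMap.ext fun x => ?_
        have := congrArg (fun F => F fun i => L.symm (x i)) h
        simpa using this
    -- The case `N = 0` is harmless because `Real.logb 2 0 = 0`.
    have : Real.logb 2 N = 0 := by interval_cases N <;> simp
    simp [this]
  -- A single message can always be sent; this keeps the supremum in `EReal` from being `⊥`.
  · have h1 : SendsClassical (E.power 1) 1 := .one _ (fun _ => Classical.arbitrary A)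
    refine le_iSup_of_le 1 (le_iSup_of_le le_rfl (le_iSup_of_le 1 (le_iSup_of_le h1 ?_)))
    simp

end ZeroCapacity

/-! ### Composition and reversal of channels -/

namespace QChannel

variable {A B C D : Type}
variable [Fintype A] [DecidableEq A] [Fintype B] [DecidableEq B]
variable [Fintype C] [DecidableEq C] [Fintype D] [DecidableEq D]

theorem apply_comp (F : QChannel B C) (E : QChannel A B) (ρ : Matrix A A ℂ) :
    (F.comp E).apply ρ = F.apply (E.apply ρ) := by
  change ∑ p : E.ι × F.ι, F.op p.2 * E.op p.1 * ρ * (F.op p.2 * E.op p.1).conjTranspose = _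
  simp only [apply, Fintype.sum_prod_type, Matrix.mul_sum, Matrix.sum_mul,
    Matrix.conjTranspose_mul, Matrix.mul_assoc]
  exact Finset.sum_comm

/-- The channel with a single isometric Kraus operator. -/
def ofIsometry (V : Matrix B A ℂ) (hV : V.conjTranspose * V = 1) : QChannel A B where
  ι := Unit
  op := fun _ => V
  complete := by simpa using hV

/-- The channel which reverses the isometries `G i` with mutually orthogonal ranges. -/
noncomputable def recovery {I : Type} [Fintype I] [DecidableEq I] (c : C) (G : I → Matrix A C ℂ)
    (hG : ∀ i j, (G i).conjTranspose * G j = if i = j then 1 else 0) : QChannel A C where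
  ι := I ⊕ A
  op := Sum.elim (fun i => (G i).conjTranspose)
    -- Whatever lies outside all the ranges is sent to the basis vector `c`, one Kraus operator for
    -- each row of the complementary projection; this makes the family complete.
    (fun y => Matrix.vecMulVec (Pi.single c 1) ((1 - ∑ i, G i * (G i).conjTranspose) y))
  complete := by
    set P : Matrix A A ℂ := ∑ i, G i * (G i).conjTranspose with hP
    have hPP : P * P = P := by
      conv_lhs => rw [hP]
      simp only [Matrix.sum_mul, Matrix.mul_sum]
      refine Finset.sum_congr rfl fun i _ => ?_
      have : ∀ j, G j * (G j).conjTranspose * (G i * (G i).conjTranspose) =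
          G j * ((G j).conjTranspose * G i) * (G i).conjTranspose := fun j => by
        simp only [Matrix.mul_assoc]
      simp only [this, hG]
      rw [Finset.sum_eq_single i (fun j _ hj => by simp [hj]) (by simp)]
      simp
    have hPH : P.conjTranspose = P := by
      simp [hP, Matrix.conjTranspose_sum, Matrix.conjTranspose_mul]
    have hQ : ∑ y, (Matrix.vecMulVec (Pi.single c 1) ((1 - P) y)).conjTranspose *
        Matrix.vecMulVec (Pi.single c (1 : ℂ)) ((1 - P) y) = (1 - P).conjTranspose * (1 - P) := by
      ext a a'
      simp [Matrix.sum_apply, Matrix.mul_apply, Matrix.vecMulVec_apply, Pi.single_apply,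
        -Matrix.sub_apply, -map_sub, -Matrix.conjTranspose_sub]
    rw [Fintype.sum_sum_type]
    simp only [Sum.elim_inl, Sum.elim_inr, Matrix.conjTranspose_conjTranspose]
    rw [hQ, ← hP, Matrix.conjTranspose_sub, hPH, Matrix.conjTranspose_one]
    simp [Matrix.mul_sub, Matrix.sub_mul, hPP]

/-- Orthogonality of the ranges makes `(G j)† G i` equal to `1` or `0`, and the complementary
projection annihilates `G i`. -/
theorem recovery_op_mul {I : Type} [Fintype I] [DecidableEq I] (c : C) (G : I → Matrix A C ℂ)
    (hG : ∀ i j, (G i).conjTranspose * G j = if i = j then 1 else 0)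
    (p : (recovery c G hG).ι) (i : I) : ∃ z : ℂ, (recovery c G hG).op p * G i = z • 1 := by
  rcases p with j | y
  · refine ⟨if j = i then 1 else 0, ?_⟩
    simp only [recovery, Sum.elim_inl, hG]
    split_ifs <;> simp
  · refine ⟨0, ?_⟩
    have h0 : (1 - ∑ j, G j * (G j).conjTranspose) * G i = 0 := by
      rw [Matrix.sub_mul, Matrix.one_mul, Matrix.sum_mul]
      simp only [Matrix.mul_assoc, hG]
      rw [Finset.sum_eq_single i (fun j _ hj => by simp [hj]) (by simp)]
      simp
    rw [zero_smul]
    ext a b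
    have := congrFun (congrFun h0 y) b
    rw [Matrix.mul_apply] at this
    simp only [recovery, Sum.elim_inr, Matrix.mul_apply, Matrix.vecMulVec_apply, mul_assoc,
      ← Finset.mul_sum]
    rw [this]
    simp

theorem sum_normSq_op (T : QChannel A B) (a : A) :
    ∑ i, ∑ b, star (T.op i b a) * T.op i b a = 1 := by
  have := congrFun (congrFun T.complete a) a
  simpa [Matrix.sum_apply, Matrix.mul_apply] using this

/-- Completeness forces the squared moduli of the scalars to sum to `1`. -/
theorem apply_eq_self_of_scalar [Nonempty A] (T : QChannel A A)
    (h : ∀ i, ∃ z : ℂ, T.op i = z • 1) (ρ : Matrix A A ℂ) : T.apply ρ = ρ := by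
  choose z hz using h
  have h1 : ∑ i, z i * star (z i) = 1 := by
    have := T.sum_normSq_op (Classical.arbitrary A)
    simpa [hz, Matrix.one_apply, mul_comm] using this
  have h2 : T.apply ρ = ∑ i, (z i * star (z i)) • ρ := by
    refine Finset.sum_congr rfl fun i _ => ?_
    simp [hz, smul_smul, mul_comm]
  rw [h2, ← Finset.sum_smul, h1, one_smul]

end QChannel

/-! ### One-shot decoding criteria -/

section OneShot

variable {B : Type} [Fintype B] [DecidableEq B]

/-- The orthogonal ranges identify the error without revealing the state, so `QChannel.recovery`
leaves only multiples of the identity. -/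
theorem SendsQuantum.of_orthogonal {N : ℕ} [NeZero N] {I : Type} [Fintype I] [DecidableEq I]
    (T : QChannel (Fin N) B) (G : I → Matrix B (Fin N) ℂ)
    (hG : ∀ i j, (G i).conjTranspose * G j = if i = j then 1 else 0)
    (hT : ∀ p, ∃ i, ∃ z : ℂ, T.op p = z • G i) : SendsQuantum T N := by
  refine ⟨1, .recovery 0 G hG, by simp, fun φ => ?_⟩
  rw [← QChannel.apply_comp, Matrix.one_mul, Matrix.conjTranspose_one, Matrix.mul_one]
  refine QChannel.apply_eq_self_of_scalar _ ?_ _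
  rintro ⟨p, q⟩
  obtain ⟨i, z, hz⟩ := hT p
  obtain ⟨w, hw⟩ := QChannel.recovery_op_mul 0 G hG q i
  refine ⟨z * w, ?_⟩
  simp only [QChannel.comp, hz, Matrix.mul_smul, hw, smul_smul]

theorem SendsClassical.of_readable {N : ℕ} (T : QChannel (Fin N) B) (f : B → Fin N)
    (hT : ∀ p b r, f b ≠ r → T.op p b r = 0) : SendsClassical T N := by
  refine ⟨fun i => Matrix.vecMulVec (Pi.single i 1) (star (Pi.single i 1)),
    fun j => Matrix.diagonal fun b => if f b = j then 1 else 0, fun i =>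
    ⟨Matrix.posSemidef_vecMulVec_self_star _, by simp [Matrix.trace_vecMulVec]⟩, fun j => ?_, ?_,
    fun i j => ?_⟩
  · rw [Matrix.posSemidef_diagonal_iff]
    intro b
    split_ifs <;> simp
  · ext b b'
    simp only [Matrix.sum_apply, Matrix.diagonal_apply, Matrix.one_apply]
    split_ifs <;> simp
  · have hentry : ∀ b, T.apply (Matrix.vecMulVec (Pi.single i 1) (star (Pi.single i 1))) b b =
        ∑ p, star (T.op p b i) * T.op p b i := by
      intro b
      simp [QChannel.apply, Matrix.sum_apply, Matrix.mul_apply, Matrix.vecMulVec_apply,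
        Pi.single_apply, mul_comm]
    have htr : ∀ M : Matrix B B ℂ, ((Matrix.diagonal fun b => if f b = j then (1 : ℂ) else 0) *
        M).trace = ∑ b, if f b = j then M b b else 0 := by
      intro M
      simp [Matrix.trace, Matrix.diagonal_mul]
    rw [htr]
    simp only [hentry]
    split_ifs with hij
    · subst hij
      rw [← T.sum_normSq_op i, Finset.sum_comm]
      refine Finset.sum_congr rfl fun b _ => ?_
      split_ifs with hb
      · rfl
      · exact (Finset.sum_eq_zero fun p _ => by simp [hT p b i hb]).symm
    · refine Finset.sum_eq_zero fun b _ => ?_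
      split_ifs with hb
      · exact Finset.sum_eq_zero fun p _ => by simp [hT p b i (by rw [hb]; exact Ne.symm hij)]
      · rfl

/-- Basis states serve as messages, and the basis measurement is pulled back through the recovery
channel in the Heisenberg picture. -/
theorem SendsQuantum.sendsClassical {A : Type} [Fintype A] [DecidableEq A] {E : QChannel A B}
    {N : ℕ} (h : SendsQuantum E N) : SendsClassical E N := by
  obtain ⟨V, F, hV, hF⟩ := h
  let e : Fin N → Matrix (Fin N) (Fin N) ℂ := fun i =>
    Matrix.vecMulVec (Pi.single i 1) (star (Pi.single i 1))
  have he : ∀ i, (e i).PosSemidef := fun i => Matrix.posSemidef_vecMulVec_self_star _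
  refine ⟨fun i => V * e i * V.conjTranspose, fun j => ∑ p, (F.op p).conjTranspose * e j * F.op p,
    fun i => ⟨(he i).mul_mul_conjTranspose_same V, ?_⟩, fun j =>
    Matrix.posSemidef_sum _ fun p _ => (he j).conjTranspose_mul_mul_same _, ?_, fun i j => ?_⟩
  · rw [Matrix.trace_mul_comm, ← Matrix.mul_assoc, hV]
    simp [e, Matrix.trace_vecMulVec]
  · have hsum : ∑ j, e j = 1 := by
      ext a b
      simp [e, Matrix.sum_apply, Matrix.vecMulVec_apply, Pi.single_apply, Matrix.one_apply]
    rw [Finset.sum_comm]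
    simp only [← Matrix.mul_sum, ← Matrix.sum_mul, hsum, Matrix.mul_one, F.complete]
  · have hj : ∀ M : Matrix B B ℂ, ((∑ p, (F.op p).conjTranspose * e j * F.op p) * M).trace =
        (e j * F.apply M).trace := by
      intro M
      simp only [QChannel.apply, Matrix.sum_mul, Matrix.mul_sum, Matrix.trace_sum]
      refine Finset.sum_congr rfl fun p _ => ?_
      rw [Matrix.mul_assoc, Matrix.mul_assoc, Matrix.trace_mul_comm]
      simp only [Matrix.mul_assoc]
    rw [hj, hF]
    simp only [e, Matrix.vecMulVec_mul_vecMulVec, Matrix.trace_vecMulVec]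
    by_cases hij : i = j
    · simp [hij]
    · simp [hij]

end OneShot

/-! ### Protocols followed through their Kraus operators up to scalars -/

section Reach

variable {X Y : Type} [Fintype X] [DecidableEq X] [Fintype Y] [DecidableEq Y]
variable {R A A' B B' J : Type} [Fintype R] [DecidableEq R] [Fintype A] [DecidableEq A]
  [Fintype A'] [DecidableEq A'] [Fintype B] [DecidableEq B] [Fintype B'] [DecidableEq B']
  [Fintype J] [DecidableEq J]

/-- Some protocol with `n` uses of `E` leads to Kraus operators which are multiples of members
of `S`. -/
def CfbReaches (E : QChannel X Y) (R : Type) [Fintype R] [DecidableEq R] (n : ℕ) (A B : Type)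
    [Fintype A] [DecidableEq A] [Fintype B] [DecidableEq B] (S : Set (Matrix (A × B) R ℂ)) : Prop :=
  ∃ T : QChannel R (A × B), CfbProtocol E R n A B T ∧ ∀ i, ∃ M ∈ S, ∃ z : ℂ, T.op i = z • M

namespace CfbReaches

variable {E : QChannel X Y} {n : ℕ} {S : Set (Matrix (A × B) R ℂ)}

theorem start (E : QChannel X Y) :
    CfbReaches E R 0 R Unit {Matrix.of fun p r => if p.1 = r then 1 else 0} := by
  refine ⟨_, .start, fun i => ⟨_, rfl, 1, ?_⟩⟩
  ext ⟨a, b⟩ r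
  simp [QChannel.relabel, QChannel.ident, Matrix.one_apply]

theorem alice (F : QChannel A A') (h : CfbReaches E R n A B S)
    (S' : Set (Matrix (A' × B) R ℂ))
    (hS : ∀ M ∈ S, ∀ i, ∃ M' ∈ S', ∃ z : ℂ, ∀ a' b r,
      ∑ a, F.op i a' a * M (a, b) r = z * M' (a', b) r) :
    CfbReaches E R n A' B S' := by
  obtain ⟨T, hT, hop⟩ := h
  refine ⟨_, .alice F hT, ?_⟩
  rintro ⟨t, i, u⟩
  obtain ⟨M, hM, z, hz⟩ := hop t
  obtain ⟨M', hM', w, hw⟩ := hS M hM i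
  refine ⟨M', hM', z * w, ?_⟩
  ext ⟨a', b⟩ r
  have : ∀ a, F.op i a' a * (z * M (a, b) r) = z * (F.op i a' a * M (a, b) r) := fun a => by ring
  simp [QChannel.comp, QChannel.tensor, QChannel.ident, hz, Matrix.mul_apply,
    Fintype.sum_prod_type, Matrix.one_apply, this, ← Finset.mul_sum, hw, mul_assoc]

theorem aliceIsometry (V : Matrix A' A ℂ) (hV : V.conjTranspose * V = 1)
    (h : CfbReaches E R n A B S) (S' : Set (Matrix (A' × B) R ℂ))
    (hS : ∀ M ∈ S, ∃ M' ∈ S', ∃ z : ℂ, ∀ a' b r,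
      ∑ a, V a' a * M (a, b) r = z * M' (a', b) r) :
    CfbReaches E R n A' B S' :=
  h.alice (.ofIsometry V hV) S' fun M hM _ => hS M hM

/-- Lets Alice strip off an isometry `G i` whose label is determined only by the Kraus operator that
occurred. -/
theorem aliceRecover {I : Type} [Fintype I] [DecidableEq I] [Nonempty A'] (G : I → Matrix A A' ℂ)
    (hG : ∀ i j, (G i).conjTranspose * G j = if i = j then 1 else 0)
    (h : CfbReaches E R n A B S) (S' : Set (Matrix (A' × B) R ℂ))
    (hS : ∀ M ∈ S, ∃ i, ∃ M' ∈ S', ∃ z : ℂ, ∀ a b r,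
      M (a, b) r = z * ∑ a', G i a a' * M' (a', b) r) :
    CfbReaches E R n A' B S' := by
  refine h.alice (.recovery (Classical.arbitrary A') G hG) S' fun M hM p => ?_
  obtain ⟨i, M', hM', z, hz⟩ := hS M hM
  obtain ⟨w, hw⟩ := QChannel.recovery_op_mul (Classical.arbitrary A') G hG p i
  refine ⟨M', hM', z * w, fun a' b r => ?_⟩
  have hw' : ∀ x, ∑ a, (QChannel.recovery (Classical.arbitrary A') G hG).op p a' a * G i a x =
      if a' = x then w else 0 := fun x => by
    have := congrFun (congrFun hw a') x
    rw [Matrix.mul_apply] at this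
    rw [this]
    simp [Matrix.one_apply]
  calc _ = ∑ a, ∑ x, (QChannel.recovery (Classical.arbitrary A') G hG).op p a' a * G i a x *
        (z * M' (x, b) r) := by
        refine Finset.sum_congr rfl fun a _ => ?_
        rw [hz, Finset.mul_sum, Finset.mul_sum]
        exact Finset.sum_congr rfl fun x _ => by ring
    _ = _ := by
        rw [Finset.sum_comm]
        simp only [← Finset.sum_mul, hw']
        simp
        ring

theorem bob (F : QChannel B B') (out : F.ι → J) (h : CfbReaches E R n A B S)
    (S' : Set (Matrix ((A × J) × B') R ℂ))
    (hS : ∀ M ∈ S, ∀ i, ∃ M' ∈ S', ∃ z : ℂ, ∀ a j b' r,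
      (if j = out i then ∑ b, F.op i b' b * M (a, b) r else 0) = z * M' ((a, j), b') r) :
    CfbReaches E R n (A × J) B' S' := by
  obtain ⟨T, hT, hop⟩ := h
  refine ⟨_, .bob F out hT, ?_⟩
  rintro ⟨t, u, i⟩
  obtain ⟨M, hM, z, hz⟩ := hop t
  obtain ⟨M', hM', w, hw⟩ := hS M hM i
  refine ⟨M', hM', z * w, ?_⟩
  ext ⟨⟨a, j⟩, b'⟩ r
  have : ∀ b, F.op i b' b * (z * M (a, b) r) = z * (F.op i b' b * M (a, b) r) := fun a => by ring
  have hw' := hw a j b' r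
  simp only [QChannel.comp, QChannel.relabel, QChannel.tensor, QChannel.ident, QChannel.record, hz,
    Matrix.mul_apply, Fintype.sum_prod_type, Matrix.one_apply, Matrix.submatrix_apply,
    Equiv.prodAssoc_apply, Matrix.kroneckerMap_apply, Matrix.of_apply, Matrix.smul_apply,
    smul_eq_mul, id_eq]
  rw [Finset.sum_eq_single a (by simp +contextual [eq_comm]) (by simp), mul_assoc, ← hw']
  split_ifs <;> simp_all [← Finset.mul_sum]

theorem bobRecover {I : Type} [Fintype I] [DecidableEq I] [Nonempty B'] (G : I → Matrix B B' ℂ)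
    (hG : ∀ i j, (G i).conjTranspose * G j = if i = j then 1 else 0)
    (h : CfbReaches E R n A B S) (S' : Set (Matrix (A × B') R ℂ))
    (hS : ∀ M ∈ S, ∃ i, ∃ M' ∈ S', ∃ z : ℂ, ∀ a b r,
      M (a, b) r = z * ∑ b', G i b b' * M' (a, b') r) :
    CfbReaches E R n A B' S' := by
  -- Every instrument of Bob sends an outcome; here it is the trivial one in `Unit`, which Alice
  -- then removes by an isometry.
  have h1 : CfbReaches E R n (A × Unit) B'
      {M | ∃ M' ∈ S', ∀ a u b r, M ((a, u), b) r = M' (a, b) r} := by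
    refine h.bob (.recovery (Classical.arbitrary B') G hG) (fun _ => ()) _ fun M hM p => ?_
    obtain ⟨i, M', hM', z, hz⟩ := hS M hM
    obtain ⟨w, hw⟩ := QChannel.recovery_op_mul (Classical.arbitrary B') G hG p i
    refine ⟨Matrix.of fun q r => M' (q.1.1, q.2) r, ⟨M', hM', fun _ _ _ _ => rfl⟩, z * w,
      fun a u b' r => ?_⟩
    have hw' : ∀ x, ∑ b, (QChannel.recovery (Classical.arbitrary B') G hG).op p b' b * G i b x =
        if b' = x then w else 0 := fun x => by
      have := congrFun (congrFun hw b') x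
      rw [Matrix.mul_apply] at this
      rw [this]
      simp [Matrix.one_apply]
    rw [if_pos rfl]
    calc _ = ∑ b, ∑ x, (QChannel.recovery (Classical.arbitrary B') G hG).op p b' b * G i b x *
          (z * M' (a, x) r) := by
          refine Finset.sum_congr rfl fun a _ => ?_
          rw [hz, Finset.mul_sum, Finset.mul_sum]
          exact Finset.sum_congr rfl fun x _ => by ring
      _ = _ := by
          rw [Finset.sum_comm]
          simp only [← Finset.sum_mul, hw']
          simp
          ring
  refine h1.aliceIsometry (Matrix.of fun a q => if q.1 = a then 1 else 0) ?_ S' ?_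
  · ext ⟨a, u⟩ ⟨a', u'⟩
    simp [Matrix.mul_apply, Matrix.one_apply]
  · rintro M ⟨M', hM', hMM'⟩
    refine ⟨M', hM', 1, fun a b r => ?_⟩
    simp [Fintype.sum_prod_type, hMM']

theorem send {S : Set (Matrix ((A × X) × B) R ℂ)} (h : CfbReaches E R n (A × X) B S)
    (S' : Set (Matrix (A × (Y × B)) R ℂ))
    (hS : ∀ M ∈ S, ∀ i, ∃ M' ∈ S', ∃ z : ℂ, ∀ a y b r,
      ∑ x, E.op i y x * M ((a, x), b) r = z * M' (a, (y, b)) r) :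
    CfbReaches E R (n + 1) A (Y × B) S' := by
  obtain ⟨T, hT, hop⟩ := h
  refine ⟨_, .send hT, ?_⟩
  rintro ⟨t, ⟨u, i⟩, v⟩
  obtain ⟨M, hM, z, hz⟩ := hop t
  obtain ⟨M', hM', w, hw⟩ := hS M hM i
  refine ⟨M', hM', z * w, ?_⟩
  ext ⟨a, y, b⟩ r
  have : ∀ x, E.op i y x * (z * M ((a, x), b) r) = z * (E.op i y x * M ((a, x), b) r) :=
    fun a => by ring
  simp only [QChannel.comp, QChannel.relabel, QChannel.tensor, QChannel.ident, hz,
    Matrix.mul_apply, Fintype.sum_prod_type, Matrix.one_apply, Matrix.submatrix_apply,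
    Equiv.prodAssoc_symm_apply, Matrix.kroneckerMap_apply, Matrix.smul_apply,
    smul_eq_mul, id_eq]
  rw [Finset.sum_eq_single a (by simp +contextual [eq_comm]) (by simp), mul_assoc, ← hw]
  simp [this, ← Finset.mul_sum]

/-- Discarding Alice's system splits a Kraus operator into its blocks at fixed `a`, so each block
must be a multiple of some `G i`. -/
theorem sendsQuantum {N : ℕ} [NeZero N] {S : Set (Matrix (A × B) (Fin N) ℂ)}
    (h : CfbReaches E (Fin N) n A B S) {I : Type} [Fintype I] [DecidableEq I]
    (G : I → Matrix B (Fin N) ℂ)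
    (hG : ∀ i j, (G i).conjTranspose * G j = if i = j then 1 else 0)
    (hS : ∀ M ∈ S, ∀ a, ∃ i, ∃ z : ℂ, ∀ b r, M (a, b) r = z * G i b r) :
    CfbSendsQuantum E n N := by
  obtain ⟨T, hT, hop⟩ := h
  refine ⟨Fin N, B, inferInstance, inferInstance, inferInstance, inferInstance, _,
    ⟨A, inferInstance, inferInstance, T, hT, rfl⟩, .of_orthogonal _ G hG ?_⟩
  rintro ⟨t, a⟩
  obtain ⟨M, hM, z, hz⟩ := hop t
  obtain ⟨i, w, hw⟩ := hS M hM a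
  refine ⟨i, z * w, ?_⟩
  ext b r
  simp [QChannel.comp, QChannel.discardFst, hz, Matrix.mul_apply, hw, mul_assoc]

theorem sendsClassical {N : ℕ} {S : Set (Matrix (A × B) (Fin N) ℂ)}
    (h : CfbReaches E (Fin N) n A B S) (f : B → Fin N)
    (hS : ∀ M ∈ S, ∀ a b r, f b ≠ r → M (a, b) r = 0) : CfbSendsClassical E n N := by
  obtain ⟨T, hT, hop⟩ := h
  refine ⟨Fin N, B, inferInstance, inferInstance, inferInstance, inferInstance, _,
    ⟨A, inferInstance, inferInstance, T, hT, rfl⟩, .of_readable _ f ?_⟩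
  rintro ⟨t, a⟩ b r hb
  obtain ⟨M, hM, z, hz⟩ := hop t
  simp [QChannel.comp, QChannel.discardFst, hz, Matrix.mul_apply, hS M hM a b r hb]

end CfbReaches

theorem zeroErrorQcfb_le_zeroErrorCcfb (E : QChannel X Y) : zeroErrorQcfb E ≤ zeroErrorCcfb E :=
  iSup_mono fun _ => iSup_mono fun _ => iSup_mono fun _ => iSup_mono' fun h =>
    let ⟨R, B, i1, i2, i3, i4, T, hT, hs⟩ := h
    ⟨⟨R, B, i1, i2, i3, i4, T, hT, hs.sendsClassical⟩, le_rfl⟩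

theorem le_zeroErrorQcfb {E : QChannel X Y} {n : ℕ} (hn : 1 ≤ n) (h : CfbSendsQuantum E n 2) :
    ((1 / n : ℝ) : EReal) ≤ zeroErrorQcfb E :=
  le_iSup_of_le n (le_iSup_of_le hn (le_iSup_of_le 2 (le_iSup_of_le h (by simp))))

theorem le_zeroErrorCcfb {E : QChannel X Y} {n : ℕ} (hn : 1 ≤ n) (h : CfbSendsClassical E n 2) :
    ((1 / n : ℝ) : EReal) ≤ zeroErrorCcfb E :=
  le_iSup_of_le n (le_iSup_of_le hn (le_iSup_of_le 2 (le_iSup_of_le h (by simp))))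

end Reach

/-! ### The filter channel and entanglement concentration -/

section FilterChannel

/-- The rows of a qubit unitary, rescaled: the Hadamard matrix times a power of the phase gate. -/
noncomputable def phasedHadamard (k : Fin 4) : Matrix (Fin 2) (Fin 2) ℂ :=
  !![1 / 2, (-Complex.I) ^ (k : ℕ) / 2; 1 / 2, -((-Complex.I) ^ (k : ℕ) / 2)]

theorem conj_two : (starRingEnd ℂ) 2 = 2 := map_ofNat _ 2

theorem star_negI_pow_mul (k : Fin 4) :
    star ((-Complex.I) ^ (k : ℕ)) * (-Complex.I) ^ (k : ℕ) = 1 := by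
  rw [star_pow, ← mul_pow]
  simp

theorem phasedHadamard_row (k : Fin 4) (s s' : Fin 2) :
    ∑ y, star (phasedHadamard k s y) * phasedHadamard k s' y = if s = s' then 1 / 2 else 0 := by
  have h := star_negI_pow_mul k
  fin_cases s <;> fin_cases s' <;> simp [phasedHadamard, conj_two] at h ⊢ <;>
    first | linear_combination h / 4 | linear_combination -h / 4

/-- Because all entries have equal modulus, changing the sign of the second column makes each row
orthogonal to its former self. This is why Bob can read the phase after the third use. -/
theorem phasedHadamard_column (k : Fin 4) (s y : Fin 2) :
    star (phasedHadamard k s y) * phasedHadamard k s y = 1 / 4 := by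
  have h := star_negI_pow_mul k
  fin_cases s <;> fin_cases y <;> simp [phasedHadamard] at h ⊢ <;>
    first | linear_combination h / 4 | norm_num

/-- The amplitudes `a, b` of a two-dimensional vector. -/
def amplitude (a b : ℝ) (s : Fin 2) : ℝ := if s = 0 then a else b

/-- The channel which, with equal probability, applies one of four filters with singular values
`a / √2, b / √2` along the axes `±X, ±Y` and reports which one. -/
noncomputable def filterChannel (a b : ℝ) (h : a ^ 2 + b ^ 2 = 1) :
    QChannel (Fin 2) (Fin 2 × Fin 4) where
  ι := Fin 4
  op := fun k => Matrix.of fun y x =>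
    if y.2 = k then (amplitude a b y.1 : ℂ) * phasedHadamard k y.1 x else 0
  complete := by
    have h' : (a : ℂ) ^ 2 + (b : ℂ) ^ 2 = 1 := by exact_mod_cast h
    ext x x'
    fin_cases x <;> fin_cases x' <;>
      simp [Matrix.sum_apply, Matrix.mul_apply, Fintype.sum_prod_type, Fin.sum_univ_four,
        phasedHadamard, amplitude, pow_succ, conj_two] <;> ring_nf <;>
      first | linear_combination h' | (simp; done) | (simp; linear_combination h')

variable {a b : ℝ} {h : a ^ 2 + b ^ 2 = 1}

theorem filterChannel_op (k : Fin 4) (s : Fin 2) (k' : Fin 4) (x : Fin 2) :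
    (filterChannel a b h).op k (s, k') x =
      if k' = k then (amplitude a b s : ℂ) * phasedHadamard k s x else 0 := rfl

/-- The reported `k` removes the cross terms. For `k = k'` the product has eigenvalues `a² / 2` and
`b² / 2` along a Pauli axis. -/
theorem filterChannel_conjTranspose_mul (k k' : Fin 4) :
    ((filterChannel a b h).op k).conjTranspose * (filterChannel a b h).op k' =
      if k = k' then (1 / 4 : ℂ) • (1 + (a ^ 2 - b ^ 2 : ℂ) •
        ![pauliX, pauliY, -pauliX, -pauliY] k) else 0 := by
  have h' : (a : ℂ) ^ 2 + (b : ℂ) ^ 2 = 1 := by exact_mod_cast h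
  by_cases hk : k = k'
  · subst hk
    rw [if_pos rfl]
    ext x x'
    rw [Matrix.mul_apply]
    simp only [Fintype.sum_prod_type, Matrix.conjTranspose_apply, filterChannel_op, Fin.sum_univ_two]
    fin_cases k <;> fin_cases x <;> fin_cases x' <;>
      simp [phasedHadamard, amplitude, pauliX, pauliY, pow_succ, conj_two] <;>
      first | linear_combination h' / 4 | ring1 |
        linear_combination h' / 4 - ((a : ℂ) ^ 2 + (b : ℂ) ^ 2) / 4 * Complex.I_sq
  · rw [if_neg hk]
    ext x x'
    rw [Matrix.mul_apply]
    refine Finset.sum_eq_zero fun y _ => ?_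
    rw [Matrix.conjTranspose_apply, filterChannel_op, filterChannel_op]
    split_ifs with h1 h2
    · exact absurd (h1.symm.trans h2) hk
    · simp
    · simp
    · simp

/-- Opposite filters add up to a multiple of `1` and differ by a multiple of `X` or `Y`, nonzero
exactly because `a² ≠ b²`. -/
theorem filterChannel_opSpace (hab : a ^ 2 ≠ b ^ 2) :
    (filterChannel a b h).opSpace = Submodule.span ℂ {1, pauliX, pauliY} := by
  have hc : (a ^ 2 - b ^ 2 : ℂ) ≠ 0 := by
    rw [sub_ne_zero]
    exact_mod_cast hab
  have h1 : (1 : Matrix (Fin 2) (Fin 2) ℂ) ∈ Submodule.span ℂ {1, pauliX, pauliY} :=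
    Submodule.subset_span (by simp)
  have hX : pauliX ∈ Submodule.span ℂ {1, pauliX, pauliY} := Submodule.subset_span (by simp)
  have hY : pauliY ∈ Submodule.span ℂ {1, pauliX, pauliY} := Submodule.subset_span (by simp)
  apply le_antisymm
  · refine Submodule.span_le.2 ?_
    rintro M ⟨k, k', rfl⟩
    rw [SetLike.mem_coe]
    refine (filterChannel_conjTranspose_mul k k').symm ▸ ?_
    split_ifs
    · refine Submodule.smul_mem _ _ (Submodule.add_mem _ h1 (Submodule.smul_mem _ _ ?_))
      fin_cases k
      · exact hX
      · exact hY
      · exact Submodule.neg_mem _ hX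
      · exact Submodule.neg_mem _ hY
    · exact Submodule.zero_mem _
  · have hK : ∀ k : Fin 4, ((1 / 4 : ℂ) • (1 + (a ^ 2 - b ^ 2 : ℂ) •
        ![pauliX, pauliY, -pauliX, -pauliY] k)) ∈ (filterChannel a b h).opSpace := fun k =>
      Submodule.subset_span ⟨k, k, by rw [filterChannel_conjTranspose_mul, if_pos rfl]⟩
    refine Submodule.span_le.2 ?_
    rintro M (rfl | rfl | rfl)
    · refine Set.mem_of_eq_of_mem ?_ (Submodule.smul_mem _ (2 : ℂ) (Submodule.add_mem _ (hK 0) (hK 2)))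
      simp
      module
    · refine Set.mem_of_eq_of_mem ?_ (Submodule.smul_mem _ (2 / (a ^ 2 - b ^ 2) : ℂ)
        (Submodule.sub_mem _ (hK 0) (hK 2)))
      simp
      match_scalars ; field_simp ; norm_num
    · refine Set.mem_of_eq_of_mem ?_ (Submodule.smul_mem _ (2 / (a ^ 2 - b ^ 2) : ℂ)
        (Submodule.sub_mem _ (hK 1) (hK 3)))
      simp
      match_scalars ; field_simp ; norm_num

theorem filterChannel_zeroErrorC (hab : a ^ 2 ≠ b ^ 2) : zeroErrorC (filterChannel a b h) = 0 := by
  -- With swapped coordinates as second factor, both diagonal entries of the rank one operator are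
  -- `x 0 * x 1`, so it has no `Z` component.
  refine zeroErrorC_eq_zero _ (LinearEquiv.funCongrLeft ℂ ℂ (Equiv.swap (0 : Fin 2) 1)) fun x => ?_
  rw [filterChannel_opSpace hab]
  have : Matrix.vecMulVec x (LinearEquiv.funCongrLeft ℂ ℂ (Equiv.swap (0 : Fin 2) 1) x) =
      (x 0 * x 1) • 1 + ((x 0 ^ 2 + x 1 ^ 2) / 2) • pauliX +
        (Complex.I * (x 0 ^ 2 - x 1 ^ 2) / 2) • pauliY := by
    ext i j
    fin_cases i <;> fin_cases j <;>
      simp [Matrix.vecMulVec_apply, pauliX, pauliY, LinearMap.funLeft] <;> ring_nf <;> simp <;> ring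
  rw [this]
  exact Submodule.add_mem _ (Submodule.add_mem _
    (Submodule.smul_mem _ _ (Submodule.subset_span (by simp)))
    (Submodule.smul_mem _ _ (Submodule.subset_span (by simp))))
    (Submodule.smul_mem _ _ (Submodule.subset_span (by simp)))

/-- The three nonzero pairs of bits. -/
def nonzeroPair : Fin 3 → Fin 2 × Fin 2 := ![(0, 1), (1, 0), (1, 1)]

/-- The product amplitude of a pair of bits. -/
def amplitudePair (a b : ℝ) (s : Fin 2 × Fin 2) : ℝ := amplitude a b s.1 * amplitude a b s.2

/-- The Kraus operators of the measurement which turns `(a|00⟩ + b|11⟩)^⊗2` into a maximally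
entangled pair of qubits. -/
noncomputable def concentration (a b : ℝ) (r : Fin 3) : Matrix (Fin 2) (Fin 2 × Fin 2) ℂ :=
  Matrix.of fun t s => if t = 0 then
    (if s = (0, 0) then ((√2 * amplitudePair a b (nonzeroPair r) : ℝ) : ℂ) else 0)
    else if s = nonzeroPair r then 1 else 0

/-- The entry at `(0, 0)` is twice the total weight of the nonzero pairs, `2 (1 - a⁴)`; requiring it
to be `1` fixes `a`. -/
theorem concentration_complete (h : a ^ 2 + b ^ 2 = 1) (ha : 2 * a ^ 4 = 1) :
    ∑ r, (concentration a b r).conjTranspose * concentration a b r = 1 := by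
  have h2 : 2 * ((a * b) ^ 2 + (b * a) ^ 2 + (b * b) ^ 2) = 1 := by
    have : b ^ 2 = 1 - a ^ 2 := by linarith
    have hb : (b * b) ^ 2 = (b ^ 2) ^ 2 := by ring
    rw [mul_pow, mul_pow, hb, this]
    linear_combination (-1 : ℝ) * ha
  have hs : ((√2 : ℝ) : ℂ) ^ 2 = 2 := by
    rw [← Complex.ofReal_pow]
    simp
  have h2' : 2 * (((a : ℂ) * b) ^ 2 + ((b : ℂ) * a) ^ 2 + ((b : ℂ) * b) ^ 2) = 1 := by
    exact_mod_cast h2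
  ext ⟨s1, s2⟩ ⟨s1', s2'⟩
  fin_cases s1 <;> fin_cases s2 <;> fin_cases s1' <;> fin_cases s2' <;>
    simp [Matrix.sum_apply, Matrix.mul_apply, Fin.sum_univ_three, concentration, nonzeroPair,
      amplitudePair, amplitude] <;>
    linear_combination (((a : ℂ) * b) ^ 2 + ((b : ℂ) * a) ^ 2 + ((b : ℂ) * b) ^ 2) * hs + h2'

/-- The pair of outcomes which belongs to the basis vectors of the concentrated state. -/
def concentrated (r : Fin 3) (t : Fin 2) : Fin 2 × Fin 2 := if t = 0 then (0, 0) else nonzeroPair r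

/-- Since `√2 a² = 1`, the filter lowers the amplitude of `(0, 0)` to that of the pair `r`. The
prefactor no longer depends on `t`: the remaining state is maximally entangled. -/
theorem sum_concentration (ha : 2 * a ^ 4 = 1) (r : Fin 3) (t : Fin 2) (g : Fin 2 × Fin 2 → ℂ) :
    ∑ s, concentration a b r t s * ((amplitudePair a b s : ℂ) * g s) =
      (amplitudePair a b (nonzeroPair r) : ℂ) * g (concentrated r t) := by
  have h1 : √2 * (a * a) = 1 := by
    rw [← Real.sqrt_mul_self (mul_self_nonneg a), ← Real.sqrt_mul (by norm_num)]
    rw [show 2 * (a * a * (a * a)) = 1 by linear_combination ha, Real.sqrt_one]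
  have h1' : ((√2 : ℝ) : ℂ) * ((a : ℂ) * a) = 1 := by exact_mod_cast h1
  fin_cases t
  · have h00 : amplitudePair a b (0, 0) = a * a := by simp [amplitudePair, amplitude]
    simp [concentration, concentrated, h00]
    linear_combination (amplitudePair a b (nonzeroPair r) : ℂ) * g (0, 0) * h1'
  · simp [concentration, concentrated]

end FilterChannel

/-! ### Coherent copying through the filter channel -/

section FilterProtocol

variable {a b : ℝ} {h : a ^ 2 + b ^ 2 = 1}

/-- Bob's measurement on the outputs of two uses of the filter channel: he reads the two reported
filters and concentrates the entanglement. -/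
noncomputable def concentrationChannel (a b : ℝ) (h : a ^ 2 + b ^ 2 = 1) (ha : 2 * a ^ 4 = 1)
    (B : Type) [Fintype B] [DecidableEq B] :
    QChannel ((Fin 2 × Fin 4) × ((Fin 2 × Fin 4) × B)) (Fin 2 × B) where
  ι := (Fin 4 × Fin 4) × Fin 3
  op := fun j => Matrix.of fun q p =>
    if p.2.1.2 = j.1.1 ∧ p.1.2 = j.1.2 ∧ p.2.2 = q.2 then
      concentration a b j.2 q.1 (p.2.1.1, p.1.1) else 0
  complete := by
    ext ⟨⟨s2, l⟩, ⟨s1, k⟩, b0⟩ ⟨⟨s2', l'⟩, ⟨s1', k'⟩, b0'⟩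
    have hc := congrFun (congrFun (concentration_complete h ha) (s1, s2)) (s1', s2')
    simp only [Matrix.sum_apply, Matrix.mul_apply, Matrix.conjTranspose_apply] at hc
    simp only [Matrix.sum_apply, Matrix.mul_apply, Matrix.conjTranspose_apply, Matrix.of_apply,
      Fintype.sum_prod_type, ite_and]
    rw [Finset.sum_eq_single k (by intro x _ hx; simp [hx.symm]) (by simp),
      Finset.sum_eq_single l (by intro x _ hx; simp [hx.symm]) (by simp)]
    have hb : ∀ (r : Fin 3) (t : Fin 2), (∑ x, star (if k = k then if l = l then if b0 = x then
        concentration a b r t (s1, s2) else 0 else 0 else 0) *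
        (if k' = k then if l' = l then if b0' = x then
        concentration a b r t (s1', s2') else 0 else 0 else 0)) =
        if k' = k ∧ l' = l ∧ b0' = b0 then
          star (concentration a b r t (s1, s2)) * concentration a b r t (s1', s2') else 0 := by
      intro r t
      rw [Finset.sum_eq_single b0 (by intro x _ hx; simp [hx.symm]) (by simp)]
      simp [ite_and]
    refine (Finset.sum_congr rfl fun r _ => Finset.sum_congr rfl fun t _ => hb r t).trans ?_
    by_cases hk : k' = k ∧ l' = l ∧ b0' = b0
    · obtain ⟨rfl, rfl, rfl⟩ := hk
      simp only [and_self, if_true, hc]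
      simp [Matrix.one_apply, and_comm]
    · simp only [if_neg hk, Finset.sum_const_zero]
      rw [Matrix.one_apply_ne]
      rintro heq
      simp only [Prod.mk.injEq] at heq
      exact hk ⟨heq.2.1.2.symm, heq.1.2.symm, heq.2.2.symm⟩

theorem concentrationChannel_op (ha : 2 * a ^ 4 = 1) (B : Type) [Fintype B] [DecidableEq B]
    (k0 l0 : Fin 4) (r : Fin 3) (t : Fin 2) (b' : B) (s2 s1 : Fin 2) (l k : Fin 4) (b0 : B) :
    (concentrationChannel a b h ha B).op ((k0, l0), r) (t, b') ((s2, l), ((s1, k), b0)) =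
      if k = k0 ∧ l = l0 ∧ b0 = b' then concentration a b r t (s1, s2) else 0 := rfl

/-- The sign of the controlled phase gate. -/
def phaseSign (x t : Fin 2) : ℂ := if x = 1 ∧ t = 1 then -1 else 1

theorem phaseSign_mul_self (x t : Fin 2) : phaseSign x t * phaseSign x t = 1 := by
  unfold phaseSign
  split_ifs <;> simp

theorem star_phaseSign (x t : Fin 2) : star (phaseSign x t) = phaseSign x t := by
  unfold phaseSign
  split_ifs <;> simp

/-- Alice's half of the entangled state after Bob's outcomes `k, l, r`. -/
noncomputable def aliceHalf (j : (Fin 4 × Fin 4) × Fin 3) (t : Fin 2) (y : Fin 2 × Fin 2) : ℂ :=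
  2 * (phasedHadamard j.1.1 (concentrated j.2 t).1 y.1 *
    phasedHadamard j.1.2 (concentrated j.2 t).2 y.2)

theorem concentrated_injective (r : Fin 3) : Function.Injective (concentrated r) := by
  revert r
  decide

/-- The pairs for `t ≠ t'` differ in some bit, and there the rows of the Hadamard factor are
orthogonal. The factor `2` in `aliceHalf` compensates two rows of norm `1/√2`. -/
theorem aliceHalf_orthonormal (j : (Fin 4 × Fin 4) × Fin 3) (t t' : Fin 2) :
    ∑ y, star (aliceHalf j t y) * aliceHalf j t' y = if t = t' then 1 else 0 := by
  have hsplit : ∑ y, star (aliceHalf j t y) * aliceHalf j t' y =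
      4 * ((∑ y, star (phasedHadamard j.1.1 (concentrated j.2 t).1 y) *
        phasedHadamard j.1.1 (concentrated j.2 t').1 y) *
      (∑ y, star (phasedHadamard j.1.2 (concentrated j.2 t).2 y) *
        phasedHadamard j.1.2 (concentrated j.2 t').2 y)) := by
    rw [Finset.sum_mul_sum, ← Fintype.sum_prod_type', Finset.mul_sum]
    refine Finset.sum_congr rfl fun y _ => ?_
    simp only [aliceHalf, star_mul', star_ofNat]
    ring
  rw [hsplit, phasedHadamard_row, phasedHadamard_row]
  by_cases htt : t = t'
  · subst htt
    norm_num
  · rw [if_neg htt]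
    have := (concentrated_injective j.2).ne htt
    rw [Ne, Prod.ext_iff, not_and_or] at this
    rcases this with h1 | h1 <;> simp [h1]

variable {A B R : Type} [Fintype A] [DecidableEq A] [Fintype B] [DecidableEq B] [Fintype R]
  [DecidableEq R]

/-- Two uses of the filter channel create a maximally entangled pair of qubits; a third use then
copies a bit of Alice's system coherently to Bob. -/
theorem CfbReaches.coherentCopy [Nonempty A] [Nonempty B] (ha : 2 * a ^ 4 = 1) {n : ℕ} (M0 : Matrix (A × B) R ℂ)
    (x : A → Fin 2) (h0 : CfbReaches (filterChannel a b h) R n A B {M0}) :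
    CfbReaches (filterChannel a b h) R (n + 3) A (Fin 2 × B)
      {Matrix.of fun p r => if p.2.1 = x p.1 then M0 (p.1, p.2.2) r else 0} := by
  have h' : (a : ℂ) ^ 2 + (b : ℂ) ^ 2 = 1 := by exact_mod_cast h
  -- Alice prepares two maximally entangled pairs
  have h1 : CfbReaches (filterChannel a b h) R n (((A × (Fin 2 × Fin 2)) × Fin 2) × Fin 2) B
      {Matrix.of fun p r => if p.1.1.1.2 = (p.1.2, p.1.1.2) then M0 (p.1.1.1.1, p.2) r else 0} := by
    refine h0.aliceIsometry (Matrix.of fun p α =>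
      if p.1.1.1 = α ∧ p.1.1.2 = (p.2, p.1.2) then 1 / 2 else 0) ?_ _ ?_
    · ext α α'
      by_cases hα : α = α'
      · subst hα
        simp [Matrix.mul_apply, Fintype.sum_prod_type, ite_and, conj_two]
        norm_num
      · simp [Matrix.mul_apply, Fintype.sum_prod_type, ite_and, hα, Ne.symm hα]
    · rintro M rfl
      refine ⟨_, rfl, 1 / 2, ?_⟩
      rintro ⟨⟨⟨α, y⟩, x2⟩, x1⟩ β r
      simp [ite_and]
  -- she sends a half of each of them
  have h2 : CfbReaches (filterChannel a b h) R (n + 1) ((A × (Fin 2 × Fin 2)) × Fin 2)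
      ((Fin 2 × Fin 4) × B)
      {M | ∃ k, M = Matrix.of fun p r => if p.1.1.2.2 = p.1.2 ∧ p.2.1.2 = k then
        (amplitude a b p.2.1.1 : ℂ) * phasedHadamard k p.2.1.1 p.1.1.2.1 * M0 (p.1.1.1, p.2.2) r
        else 0} := by
    refine h1.send _ ?_
    rintro M rfl (k : Fin 4)
    refine ⟨_, ⟨k, rfl⟩, 1, ?_⟩
    rintro ⟨⟨α, y1, y2⟩, x2⟩ ⟨s, k'⟩ β r
    by_cases hk : k' = k <;> by_cases hx : y2 = x2 <;>
      simp [filterChannel_op, hk, hx]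
  have h3 : CfbReaches (filterChannel a b h) R (n + 2) (A × (Fin 2 × Fin 2))
      ((Fin 2 × Fin 4) × ((Fin 2 × Fin 4) × B))
      {M | ∃ k l, M = Matrix.of fun p r => if p.2.2.1.2 = k ∧ p.2.1.2 = l then
        (amplitudePair a b (p.2.2.1.1, p.2.1.1) : ℂ) *
          (phasedHadamard k p.2.2.1.1 p.1.2.1 * phasedHadamard l p.2.1.1 p.1.2.2) *
            M0 (p.1.1, p.2.2.2) r
        else 0} := by
    refine h2.send _ ?_
    rintro M ⟨k, rfl⟩ (l : Fin 4)
    refine ⟨_, ⟨k, l, rfl⟩, 1, ?_⟩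
    rintro ⟨α, y1, y2⟩ ⟨s2, l'⟩ ⟨⟨s1, k'⟩, β⟩ r
    by_cases hl : l' = l <;> by_cases hk : k' = k <;>
      simp [filterChannel_op, hl, hk, amplitudePair, ite_and]
    ring
  -- Bob measures and tells Alice the outcome
  have h4 : CfbReaches (filterChannel a b h) R (n + 2)
      ((A × (Fin 2 × Fin 2)) × ((Fin 4 × Fin 4) × Fin 3)) (Fin 2 × B)
      {M | ∃ j, M = Matrix.of fun p r => if p.1.2 = j then
        aliceHalf j p.2.1 p.1.1.2 * M0 (p.1.1.1, p.2.2) r else 0} := by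
    refine h3.bob (J := (Fin 4 × Fin 4) × Fin 3) (concentrationChannel a b h ha B) (fun j => j) _ ?_
    rintro M ⟨k, l, rfl⟩ ⟨⟨k0, l0⟩, r⟩
    -- The `1/2` cancels the factor `2` of `aliceHalf`; outcomes contradicting the reported filters
    -- occur with scalar `0`.
    refine ⟨_, ⟨((k0, l0), r), rfl⟩,
      if k = k0 ∧ l = l0 then (amplitudePair a b (nonzeroPair r) : ℂ) / 2 else 0, ?_⟩
    rintro ⟨α, y1, y2⟩ j ⟨t, β⟩ ρ
    have key := sum_concentration (b := b) ha r t fun s =>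
      phasedHadamard k0 s.1 y1 * phasedHadamard l0 s.2 y2
    by_cases hj : j = ((k0, l0), r)
    · by_cases hkl : k = k0 ∧ l = l0
      · obtain ⟨rfl, rfl⟩ := hkl
        refine (if_pos hj).trans ?_
        have hsum : ∀ g : (Fin 2 × Fin 4) × ((Fin 2 × Fin 4) × B) → ℂ,
            ∑ q, (concentrationChannel a b h ha B).op ((k, l), r) (t, β) q * g q =
              ∑ s, concentration a b r t s * g ((s.2, l), ((s.1, k), β)) := by
          intro g
          simp only [Fintype.sum_prod_type, concentrationChannel_op]
          simp [ite_and]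
          ring
        rw [hsum]
        simp only [Matrix.of_apply, and_self, if_true, hj]
        simp only [← mul_assoc, ← Finset.sum_mul] at key ⊢
        rw [key, aliceHalf]
        ring
      · rw [if_neg hkl, zero_mul]
        refine (if_pos hj).trans ?_
        refine Finset.sum_eq_zero ?_
        rintro ⟨⟨s2, l'⟩, ⟨s1, k'⟩, β'⟩ _
        rw [concentrationChannel_op, Matrix.of_apply]
        split_ifs with h7 h8
        · exact absurd ⟨h8.1.symm.trans h7.1, h8.2.symm.trans h7.2.1⟩ hkl
        all_goals simp
    · refine (if_neg hj).trans ?_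
      simp [hj]
  -- Alice undoes the filters and stores the bit in the phase of the entangled pair
  have h5 : CfbReaches (filterChannel a b h) R (n + 2) (A × Fin 2) (Fin 2 × B)
      {Matrix.of fun p r => if p.2.1 = p.1.2 then
        phaseSign (x p.1.1) p.1.2 * M0 (p.1.1, p.2.2) r else 0} := by
    -- The sign in this isometry is its own inverse, so reversing the isometry undoes the filters
    -- and imprints the phase at once.
    refine h4.aliceRecover (fun j => Matrix.of fun p q => if p.1.1 = q.1 ∧ p.2 = j then
      phaseSign (x q.1) q.2 * aliceHalf j q.2 p.1.2 else 0) ?_ _ ?_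
    · intro j j'
      ext ⟨α, t⟩ ⟨α', t'⟩
      rw [Matrix.mul_apply, Fintype.sum_prod_type, Fintype.sum_prod_type]
      simp only [Matrix.conjTranspose_apply, Matrix.of_apply]
      by_cases hj : j = j'
      · subst hj
        by_cases hα : α = α'
        · subst hα
          have hsum : ∀ y, (starRingEnd ℂ) (phaseSign (x α) t) * (starRingEnd ℂ) (aliceHalf j t y) *
              (phaseSign (x α) t' * aliceHalf j t' y) = phaseSign (x α) t * phaseSign (x α) t' *
              (star (aliceHalf j t y) * aliceHalf j t' y) := fun y => by
            rw [starRingEnd_apply, starRingEnd_apply, star_phaseSign]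
            ring
          simp only [ite_and, if_true, apply_ite star,
            star_zero, mul_ite, mul_zero]
          simp
          refine (Finset.sum_congr rfl fun y _ => hsum y).trans ?_
          rw [← Finset.mul_sum, aliceHalf_orthonormal]
          by_cases ht : t = t'
          · subst ht
            simp [phaseSign_mul_self]
          · simp [ht]
        · simp [ite_and, hα, Ne.symm hα]
      · simp [ite_and, hj, Ne.symm hj]
    · rintro M ⟨j, rfl⟩
      refine ⟨j, _, rfl, 1, ?_⟩
      rintro ⟨⟨α, y⟩, j'⟩ ⟨t, β⟩ r
      by_cases hj : j' = j
      · simp [Fintype.sum_prod_type, ite_and, hj]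
        linear_combination -(aliceHalf j t y * M0 (α, β) r) * phaseSign_mul_self (x α) t
      · simp [hj]
  have h6 : CfbReaches (filterChannel a b h) R (n + 3) A ((Fin 2 × Fin 4) × (Fin 2 × B))
      {M | ∃ k, M = Matrix.of fun p r => if p.2.1.2 = k then
        (amplitude a b p.2.1.1 : ℂ) * phasedHadamard k p.2.1.1 p.2.2.1 *
          (phaseSign (x p.1) p.2.2.1 * M0 (p.1, p.2.2.2) r) else 0} := by
    refine h5.send _ ?_
    rintro M rfl (k : Fin 4)
    refine ⟨_, ⟨k, rfl⟩, 1, ?_⟩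
    rintro α ⟨s, k'⟩ ⟨t, β⟩ r
    by_cases hk : k' = k <;> simp [filterChannel_op, hk]
  -- Bob reads the phase
  refine h6.bobRecover (fun k => Matrix.of fun p q => if p.1.2 = k ∧ p.2.2 = q.2 then
      ((√2 * amplitude a b p.1.1 : ℝ) : ℂ) * phasedHadamard k p.1.1 p.2.1 * phaseSign q.1 p.2.1
      else 0) ?_ _ ?_
  · intro k k'
    ext ⟨t, β⟩ ⟨t', β'⟩
    rw [Matrix.mul_apply]
    simp only [Fintype.sum_prod_type, Matrix.conjTranspose_apply, Matrix.of_apply]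
    by_cases hk : k = k'
    · subst hk
      by_cases hβ : β = β'
      · subst hβ
        have c00 := phasedHadamard_column k 0 0
        have c01 := phasedHadamard_column k 0 1
        have c10 := phasedHadamard_column k 1 0
        have c11 := phasedHadamard_column k 1 1
        have hs : ((√2 : ℝ) : ℂ) ^ 2 = 2 := by
          rw [← Complex.ofReal_pow]
          simp
        fin_cases t <;> fin_cases t' <;>
          simp [ite_and, phaseSign, amplitude] at c00 c01 c10 c11 ⊢ <;>
          first
          | linear_combination (√2 : ℂ) ^ 2 * (a : ℂ) ^ 2 * (c00 + c01) +
              (√2 : ℂ) ^ 2 * (b : ℂ) ^ 2 * (c10 + c11) + ((a : ℂ) ^ 2 + (b : ℂ) ^ 2) / 2 * hs + h'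
          | linear_combination (√2 : ℂ) ^ 2 * (a : ℂ) ^ 2 * (c00 - c01) +
              (√2 : ℂ) ^ 2 * (b : ℂ) ^ 2 * (c10 - c11)
      · simp [ite_and, hβ, Ne.symm hβ]
    · simp [ite_and, hk, Ne.symm hk]
  · rintro M ⟨k, rfl⟩
    refine ⟨k, _, rfl, ((√2 : ℝ) : ℂ)⁻¹, ?_⟩
    rintro α ⟨⟨s, k'⟩, t, β⟩ r
    by_cases hk : k' = k
    · simp [Fintype.sum_prod_type, ite_and, hk]
      have hs : ((√2 : ℝ) : ℂ) ≠ 0 := by simp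
      field_simp
    · simp [hk]

variable (h) in
theorem filterChannel_cfbSendsClassical (ha : 2 * a ^ 4 = 1) :
    CfbSendsClassical (filterChannel a b h) 3 2 := by
  refine (CfbReaches.coherentCopy (R := Fin 2) ha _ id (.start _)).sendsClassical Prod.fst ?_
  rintro M rfl α ⟨t, u⟩ r ht
  by_cases h1 : t = α
  · by_cases h2 : α = r
    · exact absurd (h1.trans h2) ht
    · simp [h2]
  · simp [h1]

-- After a coherent copy Alice applies a Hadamard gate and copies again. Her new bit `s` now also
-- reaches Bob; it is the only trace of her system and determines the sign on his first copy, which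
-- he removes.
variable (h) in
theorem filterChannel_cfbSendsQuantum (ha : 2 * a ^ 4 = 1) :
    CfbSendsQuantum (filterChannel a b h) 6 2 := by
  have h1 := CfbReaches.coherentCopy (R := Fin 2) ha _ id (.start (filterChannel a b h))
  have h2 : CfbReaches (filterChannel a b h) (Fin 2) 3 (Fin 2) (Fin 2 × Unit)
      {Matrix.of fun p r => if p.2.1 = r then phaseSign p.1 r else 0} := by
    refine h1.aliceIsometry (Matrix.of fun s t => ((√2 : ℝ) : ℂ)⁻¹ * phaseSign s t) ?_ _ ?_
    · have hs : (((√2 : ℝ) : ℂ)⁻¹) ^ 2 = 1 / 2 := by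
        rw [inv_pow, ← Complex.ofReal_pow]
        simp
      ext s t
      fin_cases s <;> fin_cases t <;> simp [Matrix.mul_apply, phaseSign] <;>
        linear_combination 2 * hs
    · rintro M rfl
      refine ⟨_, rfl, ((√2 : ℝ) : ℂ)⁻¹, ?_⟩
      rintro s ⟨t, u⟩ r
      fin_cases s <;> fin_cases t <;> fin_cases r <;> simp [phaseSign]
  have h3 := CfbReaches.coherentCopy ha _ id h2
  refine h3.sendsQuantum (fun α => Matrix.of fun (q : Fin 2 × (Fin 2 × Unit)) r =>
    if q.1 = α ∧ q.2.1 = r then phaseSign α r else 0) ?_ ?_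
  · intro α α'
    ext r r'
    fin_cases α <;> fin_cases α' <;> fin_cases r <;> fin_cases r' <;>
      simp [Matrix.mul_apply, Fintype.sum_prod_type, phaseSign]
  · rintro M rfl α
    refine ⟨α, 1, ?_⟩
    rintro ⟨t, s, u⟩ r
    simp [ite_and]

theorem exists_filterChannel_parameters : ∃ a b : ℝ, a ^ 2 + b ^ 2 = 1 ∧ 2 * a ^ 4 = 1 := by
  have h0 : 0 ≤ √(1 / 2 : ℝ) := Real.sqrt_nonneg _
  have h1 : √(1 / 2 : ℝ) ^ 2 = 1 / 2 := Real.sq_sqrt (by norm_num)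
  have h2 : √(√(1 / 2 : ℝ)) ^ 2 = √(1 / 2) := Real.sq_sqrt h0
  refine ⟨√√(1 / 2), √(1 - √(1 / 2)), ?_, ?_⟩
  · rw [h2, Real.sq_sqrt (by nlinarith)]
    ring
  · rw [show (√(√(1 / 2 : ℝ))) ^ 4 = (√(√(1 / 2 : ℝ)) ^ 2) ^ 2 by ring, h2, h1]
    norm_num

theorem exists_channel_opSpace_eq_span_pauli : ∃ E : QChannel (Fin 2) (Fin 2 × Fin 4),
    E.opSpace = Submodule.span ℂ {1, pauliX, pauliY} ∧
    zeroErrorC E = 0 ∧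
    ((1 / 3 : ℝ) : EReal) ≤ zeroErrorCcfb E ∧
    ((1 / 8 : ℝ) : EReal) ≤ zeroErrorQcfb E := by
  obtain ⟨a, b, h, ha⟩ := exists_filterChannel_parameters
  have hab : a ^ 2 ≠ b ^ 2 := by
    intro hab
    have : a ^ 2 = 1 / 2 := by linarith
    rw [show a ^ 4 = (a ^ 2) ^ 2 by ring, this] at ha
    norm_num at ha
  refine ⟨filterChannel a b h, filterChannel_opSpace hab, filterChannel_zeroErrorC hab, ?_, ?_⟩
  · simpa using le_zeroErrorCcfb (by norm_num) (filterChannel_cfbSendsClassical h ha)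
  -- One qubit in six uses gives the stronger bound `1/6`.
  · refine le_trans ?_ (le_zeroErrorQcfb (by norm_num) (filterChannel_cfbSendsQuantum h ha))
    rw [EReal.coe_le_coe_iff]
    norm_num

end FilterProtocol

/-! ### The controlled channel: protocol and vanishing capacity -/

section ControlledChannel

variable {N d : ℕ} [NeZero N] {ψ : Fin N → OrthonormalBasis (Fin 2) ℂ (EuclideanSpace ℂ (Fin 2))}
  {U : Fin N → Matrix.unitaryGroup (Fin d) ℂ}

/-- The unitary applied to the data when the control is found in the state `ψ k j`. -/
def conditionalUnitary (U : Fin N → Matrix.unitaryGroup (Fin d) ℂ) (k : Fin N) (j : Fin 2) :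
    Matrix (Fin d) (Fin d) ℂ :=
  if j = 0 then 1 else (U k : Matrix (Fin d) (Fin d) ℂ)

omit [NeZero N] in
theorem conditionalUnitary_star_mul_self (k : Fin N) (j : Fin 2) :
    (conditionalUnitary U k j).conjTranspose * conditionalUnitary U k j = 1 := by
  unfold conditionalUnitary
  split_ifs
  · simp
  · exact Matrix.UnitaryGroup.star_mul_self (U k)

omit [NeZero N] in
theorem conditionalUnitary_column (k : Fin N) (j : Fin 2) (x y : Fin d) :
    ∑ z, star (conditionalUnitary U k j z x) * conditionalUnitary U k j z y =
      if x = y then 1 else 0 := by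
  have := congrFun (congrFun (conditionalUnitary_star_mul_self (U := U) k j) x) y
  rwa [Matrix.mul_apply, Matrix.one_apply] at this

omit [NeZero N] in
theorem conditionalUnitary_row (k : Fin N) (j : Fin 2) (x y : Fin d) :
    ∑ z, star (conditionalUnitary U k j x z) * conditionalUnitary U k j y z =
      if x = y then 1 else 0 := by
  have h := mul_eq_one_comm.1 (conditionalUnitary_star_mul_self (U := U) k j)
  have := congrFun (congrFun h y) x
  rw [Matrix.mul_apply, Matrix.one_apply] at this
  simpa [mul_comm, eq_comm] using this

omit [NeZero N] in
theorem sum_star_basis_mul_basis (k : Fin N) (j j' : Fin 2) :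
    ∑ c, star (ψ k j c) * ψ k j' c = if j = j' then 1 else 0 := by
  rw [← orthonormal_iff_ite.1 (ψ k).orthonormal j j', PiLp.inner_apply]
  simp [mul_comm]

theorem sum_star_mul_mul {C D : Type*} [Fintype C] [Fintype D] (f f' : C → ℂ) (g g' : D → ℂ) :
    ∑ c, ∑ z, star (f c * g z) * (f' c * g' z) =
      (∑ c, star (f c) * f' c) * ∑ z, star (g z) * g' z := by
  rw [Finset.sum_mul_sum]
  refine Finset.sum_congr rfl fun c _ => Finset.sum_congr rfl fun z _ => ?_
  rw [star_mul']
  ring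

theorem controlledChannel_op (k : Fin N) (j : Fin 2) (k' : Fin N) (y : Fin d) (c : Fin 2)
    (x : Fin d) : (controlledChannel N d ψ U).op (k, j) (k', y) (c, x) =
      ((1 / Real.sqrt N : ℝ) : ℂ) *
        (if k' = k then ψ k j c * conditionalUnitary U k j y x else 0) := by
  by_cases hk : k' = k <;>
    simp [controlledChannel, conditionalUnitary, Matrix.vecMulVec_apply, hk]

/-- Reading the outcome `k` of the controlled channel. -/
def readChannel (N d : ℕ) : QChannel ((Fin N × Fin d) × Unit) (Fin d) where
  ι := Fin N
  op := fun k => Matrix.of fun y p => if p.1.1 = k ∧ p.1.2 = y then 1 else 0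
  complete := by
    ext ⟨⟨k, y⟩, u⟩ ⟨⟨k', y'⟩, u'⟩
    by_cases hk : k = k' <;> by_cases hy : y = y' <;>
      simp [Matrix.sum_apply, Matrix.mul_apply, ite_and, hk, hy, Matrix.one_apply, eq_comm]

theorem readChannel_op (N d : ℕ) (k k' : Fin N) (y y' : Fin d) (u : Unit) :
    (readChannel N d).op k y ((k', y'), u) = if k' = k ∧ y' = y then 1 else 0 := rfl

theorem controlledChannel_cfbSendsQuantum
    (ψ : Fin N → OrthonormalBasis (Fin 2) ℂ (EuclideanSpace ℂ (Fin 2)))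
    (U : Fin N → Matrix.unitaryGroup (Fin 2) ℂ) :
    CfbSendsQuantum (controlledChannel N 2 ψ U) 2 2 := by
  have h0 := CfbReaches.start (R := Fin 2) (controlledChannel N 2 ψ U)
  -- Alice prepares two maximally entangled pairs and sends a half of each of them
  have h1 : CfbReaches (controlledChannel N 2 ψ U) (Fin 2) 0
      ((Fin 2 × (Fin 2 × Fin 2)) × (Fin 2 × Fin 2)) Unit
      {Matrix.of fun p r => if p.1.1.2 = p.1.2 ∧ p.1.1.1 = r then 1 else 0} := by
    refine h0.aliceIsometry (Matrix.of fun p f =>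
      if p.1.1 = f ∧ p.1.2 = p.2 then 1 / 2 else 0) ?_ _ ?_
    · ext f f'
      by_cases hf : f = f'
      · subst hf
        simp [Matrix.mul_apply, Fintype.sum_prod_type, ite_and, conj_two]
        norm_num
      · simp [Matrix.mul_apply, Fintype.sum_prod_type, ite_and, hf, Ne.symm hf]
    · rintro M rfl
      refine ⟨_, rfl, 1 / 2, ?_⟩
      rintro ⟨⟨f, q⟩, p⟩ u r
      simp [ite_and]
      split_ifs <;> rfl
  have h2 : CfbReaches (controlledChannel N 2 ψ U) (Fin 2) 1
      (Fin 2 × (Fin 2 × Fin 2)) ((Fin N × Fin 2) × Unit)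
      {M | ∃ k j, M = Matrix.of fun p r => if p.2.1.1 = k ∧ p.1.1 = r then
        ψ k j p.1.2.1 * conditionalUnitary U k j p.2.1.2 p.1.2.2 else 0} := by
    refine h1.send _ ?_
    rintro M rfl ⟨k, j⟩
    refine ⟨_, ⟨k, j, rfl⟩, ((1 / Real.sqrt N : ℝ) : ℂ), ?_⟩
    rintro ⟨f, c, x⟩ ⟨k', y⟩ u r
    simp only [Fintype.sum_prod_type]
    by_cases hk : k' = k <;> by_cases hf : f = r <;>
      simp [controlledChannel_op, hk, hf, ite_and]
  -- Bob reads `k` and tells it to Alice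
  have h3 : CfbReaches (controlledChannel N 2 ψ U) (Fin 2) 1
      ((Fin 2 × (Fin 2 × Fin 2)) × Fin N) (Fin 2)
      {M | ∃ k j, M = Matrix.of fun p r => if p.1.2 = k ∧ p.1.1.1 = r then
        ψ k j p.1.1.2.1 * conditionalUnitary U k j p.2 p.1.1.2.2 else 0} := by
    refine h2.bob (J := Fin N) (readChannel N 2) (fun k => k) _ ?_
    rintro M ⟨k, j, rfl⟩ (k0 : Fin N)
    refine ⟨_, ⟨k, j, rfl⟩, if k = k0 then 1 else 0, ?_⟩
    rintro ⟨f, c, x⟩ k' y r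
    simp only [Fintype.sum_prod_type, readChannel_op]
    by_cases hk : k' = k0 <;> by_cases hk0 : k = k0
    · subst hk hk0
      simp [ite_and]
    · subst hk
      simp [ite_and, hk0, Ne.symm hk0]
    · subst hk0
      simp [hk]
    · simp [hk, hk0]
  -- Alice measures `j` and restores the second pair, which she uses as control
  have h4 : CfbReaches (controlledChannel N 2 ψ U) (Fin 2) 1 (Unit × (Fin 2 × Fin 2)) (Fin 2)
      {Matrix.of fun p r => if p.1.2.1 = p.2 ∧ p.1.2.2 = r then 1 else 0} := by
    refine h3.aliceRecover (fun i : Fin N × Fin 2 => Matrix.of fun p q =>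
      if p.2 = i.1 ∧ p.1.1 = q.2.2 then
        ψ i.1 i.2 p.1.2.1 * conditionalUnitary U i.1 i.2 q.2.1 p.1.2.2 else 0) ?_ _ ?_
    · rintro ⟨k, j⟩ ⟨k', j'⟩
      ext ⟨u, x, f⟩ ⟨u', x', f'⟩
      rw [Matrix.mul_apply]
      simp only [Fintype.sum_prod_type, Matrix.conjTranspose_apply, Matrix.of_apply]
      have hterm : ∀ (f0 c z : Fin 2) (k0 : Fin N),
          star (if k0 = k ∧ f0 = f then ψ k j c * conditionalUnitary U k j x z else 0) *
            (if k0 = k' ∧ f0 = f' then ψ k' j' c * conditionalUnitary U k' j' x' z else 0) =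
          if k0 = k then if f0 = f then if k = k' ∧ f = f' then
            star (ψ k j c * conditionalUnitary U k j x z) *
              (ψ k' j' c * conditionalUnitary U k' j' x' z) else 0 else 0 else 0 := by
        intro f0 c z k0
        by_cases h7 : k0 = k <;> by_cases h8 : f0 = f <;> simp [h7, h8]
      refine (Finset.sum_congr rfl fun f0 _ => Finset.sum_congr rfl fun c _ =>
        Finset.sum_congr rfl fun z _ => Finset.sum_congr rfl fun k0 _ => hterm f0 c z k0).trans ?_
      simp only [Finset.sum_ite_eq', Finset.mem_univ, if_true]
      rw [Finset.sum_eq_single f (fun f0 _ h7 => by simp [h7]) (by simp)]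
      by_cases hkf : k = k' ∧ f = f'
      · obtain ⟨rfl, rfl⟩ := hkf
        simp only [and_self, if_true]
        rw [sum_star_mul_mul, sum_star_basis_mul_basis]
        by_cases hj : j = j'
        · subst hj
          rw [conditionalUnitary_row]
          simp [Matrix.one_apply]
        · simp [hj]
      · simp only [if_neg hkf]
        by_cases hk : k = k'
        · have hf : f ≠ f' := fun hf => hkf ⟨hk, hf⟩
          split_ifs <;> simp [hf]
        · simp [hk]
    · rintro M ⟨k, j, rfl⟩
      refine ⟨(k, j), _, rfl, 1, ?_⟩
      rintro ⟨⟨f, c, x⟩, k'⟩ y r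
      simp only [Fintype.sum_prod_type]
      by_cases hk : k' = k <;> by_cases hf : f = r <;> simp [hk, hf, ite_and]
  have h5 : CfbReaches (controlledChannel N 2 ψ U) (Fin 2) 2 Unit ((Fin N × Fin 2) × Fin 2)
      {M | ∃ k j, M = Matrix.of fun p r => if p.2.1.1 = k then
        ψ k j p.2.2 * conditionalUnitary U k j p.2.1.2 r else 0} := by
    refine h4.send _ ?_
    rintro M rfl ⟨k, j⟩
    refine ⟨_, ⟨k, j, rfl⟩, ((1 / Real.sqrt N : ℝ) : ℂ), ?_⟩
    rintro u ⟨k', y⟩ z r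
    simp only [Fintype.sum_prod_type]
    by_cases hk : k' = k <;>
      simp [controlledChannel_op, hk, ite_and]
  -- The channel measured the control in the conjugate basis, which leaves Bob's half of the pair in
  -- `ψ k j`. With `k` reported, orthogonality of the basis reveals `j`.
  refine h5.sendsQuantum (fun i : Fin N × Fin 2 => Matrix.of fun p r => if p.1.1 = i.1 then
    ψ i.1 i.2 p.2 * conditionalUnitary U i.1 i.2 p.1.2 r else 0) ?_ ?_
  · rintro ⟨k, j⟩ ⟨k', j'⟩
    ext r r'
    rw [Matrix.mul_apply]
    simp only [Fintype.sum_prod_type, Matrix.conjTranspose_apply, Matrix.of_apply]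
    have hterm : ∀ (k0 : Fin N) (z c : Fin 2),
        star (if k0 = k then ψ k j c * conditionalUnitary U k j z r else 0) *
          (if k0 = k' then ψ k' j' c * conditionalUnitary U k' j' z r' else 0) =
        if k0 = k then if k = k' then star (ψ k j c * conditionalUnitary U k j z r) *
          (ψ k' j' c * conditionalUnitary U k' j' z r') else 0 else 0 := by
      intro k0 z c
      by_cases h7 : k0 = k <;> simp [h7]
    refine (Finset.sum_congr rfl fun k0 _ => Finset.sum_congr rfl fun z _ =>
      Finset.sum_congr rfl fun c _ => hterm k0 z c).trans ?_
    rw [Finset.sum_eq_single k (fun k0 _ h7 => by simp [h7]) (by simp)]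
    by_cases hk : k = k'
    · subst hk
      simp only [if_true]
      rw [Finset.sum_comm, sum_star_mul_mul, sum_star_basis_mul_basis]
      by_cases hj : j = j'
      · subst hj
        rw [conditionalUnitary_column]
        simp [Matrix.one_apply]
      · simp [hj]
    · simp [hk]
  · rintro M ⟨k, j, rfl⟩ u
    refine ⟨(k, j), 1, ?_⟩
    rintro p r
    simp

/-- The transposed adjugate of a two by two matrix, as a linear map on its entries. -/
def cofactorEquiv : ((Fin 2 × Fin 2) → ℂ) ≃ₗ[ℂ] ((Fin 2 × Fin 2) → ℂ) where
  toFun x := fun p => (if p.1 = p.2 then 1 else -1) * x (1 - p.1, 1 - p.2)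
  invFun x := fun p => (if p.1 = p.2 then 1 else -1) * x (1 - p.1, 1 - p.2)
  map_add' x y := by
    ext p
    simp [mul_add]
  map_smul' z x := by
    ext p
    simp [mul_left_comm]
  left_inv x := by
    ext ⟨i, j⟩
    fin_cases i <;> fin_cases j <;> simp
  right_inv x := by
    ext ⟨i, j⟩
    fin_cases i <;> fin_cases j <;> simp

/-- Double orthogonal complement: a functional vanishing on `S` but not at `M` is a trace against
some `W`, and this `W` lies in `hsPerp S`. -/
theorem mem_of_hsPerp {A : Type} [Fintype A] [DecidableEq A] (S : Submodule ℂ (Matrix A A ℂ))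
    {M : Matrix A A ℂ} (hM : ∀ W ∈ hsPerp S, (W.conjTranspose * M).trace = 0) : M ∈ S := by
  by_contra h
  obtain ⟨f, hf, hS⟩ := Submodule.exists_le_ker_of_notMem h
  let W : Matrix A A ℂ := Matrix.of fun i j => star (f (Matrix.single i j 1))
  have hW : ∀ K : Matrix A A ℂ, (W.conjTranspose * K).trace = f K := by
    intro K
    conv_rhs => rw [Matrix.matrix_eq_sum_single K]
    simp only [map_sum, Matrix.trace, Matrix.diag, Matrix.mul_apply, Matrix.conjTranspose_apply,
      W, Matrix.of_apply, star_star]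
    rw [Finset.sum_comm]
    refine Finset.sum_congr rfl fun i _ => Finset.sum_congr rfl fun j _ => ?_
    rw [show Matrix.single i j (K i j) = K i j • Matrix.single i j (1 : ℂ) by simp, map_smul,
      smul_eq_mul, mul_comm]
  refine hf ?_
  rw [← hW]
  refine hM W fun K hK => ?_
  have h0 : f K = 0 := hS hK
  rw [← hW] at h0
  rw [← star_eq_zero, ← Matrix.trace_conjTranspose, Matrix.conjTranspose_mul,
    Matrix.conjTranspose_conjTranspose, h0]

/-- For `x` read as a matrix, `xᵀ` times its cofactor matrix is `det x • 1`. Hence `x (L x)ᵀ` pairs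
with `1 ⊗ D` to `det x` times the conjugate of `tr D`, which is zero. -/
theorem zeroErrorC_eq_zero_of_hsPerp {B : Type} [Fintype B] [DecidableEq B]
    (E : QChannel (Fin 2 × Fin 2) B)
    (hE : hsPerp E.opSpace ⊆ {M | ∃ D : Matrix (Fin 2) (Fin 2) ℂ, D.trace = 0 ∧
      M = (1 : Matrix (Fin 2) (Fin 2) ℂ) ⊗ₖ D}) : zeroErrorC E = 0 := by
  refine zeroErrorC_eq_zero _ cofactorEquiv fun x => mem_of_hsPerp _ fun W hW => ?_
  obtain ⟨D, hD, rfl⟩ := hE hW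
  have hD' : star (D 0 0) + star (D 1 1) = 0 := by
    rw [← star_add, ← Matrix.trace_fin_two, hD, star_zero]
  simp [Matrix.trace, Matrix.mul_apply, Fintype.sum_prod_type, Matrix.vecMulVec_apply,
    cofactorEquiv, Matrix.one_apply] at hD' ⊢
  linear_combination (x (0, 0) * x (1, 1) - x (0, 1) * x (1, 0)) * hD'

end ControlledChannel

/-! ### The orthogonal complement for the controlled channel -/

section ControlledChannelComplement

variable {N d : ℕ} [NeZero N] {ψ : Fin N → OrthonormalBasis (Fin 2) ℂ (EuclideanSpace ℂ (Fin 2))}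
  {U : Fin N → Matrix.unitaryGroup (Fin d) ℂ}

theorem controlledChannel_conjTranspose_mul (k k' : Fin N) (j j' : Fin 2) (c c' : Fin 2)
    (x x' : Fin d) :
    (((controlledChannel N d ψ U).op (k, j)).conjTranspose *
      (controlledChannel N d ψ U).op (k', j')) (c, x) (c', x') =
      if k = k' then ((1 / Real.sqrt N : ℝ) : ℂ) ^ 2 * (star (ψ k j c) * ψ k j' c' *
        ((conditionalUnitary U k j).conjTranspose * conditionalUnitary U k j') x x') else 0 := by
  have hz : star ((1 / Real.sqrt N : ℝ) : ℂ) = ((1 / Real.sqrt N : ℝ) : ℂ) := Complex.conj_ofReal _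
  rw [Matrix.mul_apply, Fintype.sum_prod_type]
  simp only [Matrix.conjTranspose_apply, controlledChannel_op]
  rw [Finset.sum_eq_single k (fun k0 _ h => by simp [h]) (by simp)]
  by_cases hk : k = k'
  · subst hk
    simp only [if_true, Matrix.mul_apply, Matrix.conjTranspose_apply, Finset.mul_sum, star_mul', hz]
    exact Finset.sum_congr rfl fun y _ => by ring
  · simp [hk]

/-- The pairing of a matrix with the operator `E_{kj}† E_{kj'}` of the controlled channel. -/
noncomputable def controlledPairing
    (ψ : Fin N → OrthonormalBasis (Fin 2) ℂ (EuclideanSpace ℂ (Fin 2)))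
    (U : Fin N → Matrix.unitaryGroup (Fin d) ℂ) (k : Fin N) (j j' : Fin 2)
    (M : Matrix (Fin 2 × Fin d) (Fin 2 × Fin d) ℂ) : ℂ :=
  ∑ x, ∑ x', star (((conditionalUnitary U k j).conjTranspose * conditionalUnitary U k j') x x') *
    ∑ c, ∑ c', ψ k j c * star (ψ k j' c') * M (c, x) (c', x')

theorem controlledChannel_trace (k k' : Fin N) (j j' : Fin 2)
    (M : Matrix (Fin 2 × Fin d) (Fin 2 × Fin d) ℂ) :
    ((((controlledChannel N d ψ U).op (k, j)).conjTranspose *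
      (controlledChannel N d ψ U).op (k', j')).conjTranspose * M).trace =
      if k = k' then ((1 / Real.sqrt N : ℝ) : ℂ) ^ 2 * controlledPairing ψ U k j j' M else 0 := by
  have hz : star ((1 / Real.sqrt N : ℝ) : ℂ) = ((1 / Real.sqrt N : ℝ) : ℂ) := Complex.conj_ofReal _
  simp only [Matrix.trace, Matrix.diag]
  simp_rw [Matrix.mul_apply (N := M), Matrix.conjTranspose_apply]
  simp only [Fintype.sum_prod_type, controlledChannel_conjTranspose_mul]
  by_cases hk : k = k'
  · subst hk
    simp only [if_true, controlledPairing, Finset.mul_sum, star_mul', star_pow, hz, star_star]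
    refine (Finset.sum_congr rfl fun _ _ => (Finset.sum_congr rfl fun _ _ =>
      Finset.sum_comm).trans Finset.sum_comm).trans (Finset.sum_comm.trans
        (Finset.sum_congr rfl fun _ _ => Finset.sum_comm.trans
          (Finset.sum_congr rfl fun _ _ => Finset.sum_comm.trans
            (Finset.sum_congr rfl fun _ _ => Finset.sum_congr rfl fun _ _ => ?_))))
    ring
  · simp [hk]

theorem mem_hsPerp_controlledChannel (M : Matrix (Fin 2 × Fin d) (Fin 2 × Fin d) ℂ) :
    M ∈ hsPerp (controlledChannel N d ψ U).opSpace ↔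
      ∀ k j j', controlledPairing ψ U k j j' M = 0 := by
  have hN : ((1 / Real.sqrt N : ℝ) : ℂ) ^ 2 ≠ 0 := by
    have : (N : ℝ) ≠ 0 := by exact_mod_cast NeZero.ne N
    have h0 : 0 < (N : ℝ) := lt_of_le_of_ne (Nat.cast_nonneg N) this.symm
    exact pow_ne_zero _ (by exact_mod_cast (by positivity : (1 / Real.sqrt N : ℝ) ≠ 0))
  constructor
  · intro hM k j j'
    have := hM _ (Submodule.subset_span ⟨(k, j), (k, j'), rfl⟩)
    rw [controlledChannel_trace, if_pos rfl] at this
    exact (mul_eq_zero.1 this).resolve_left hN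
  · intro h K hK
    induction hK using Submodule.span_induction with
    | mem K hK =>
      obtain ⟨⟨k, j⟩, ⟨k', j'⟩, rfl⟩ := hK
      refine (controlledChannel_trace k k' j j' M).trans ?_
      rw [h, mul_zero, ite_self]
    | zero => simp
    | add K K' _ _ h1 h2 => rw [Matrix.conjTranspose_add, Matrix.add_mul, Matrix.trace_add, h1, h2,
        add_zero]
    | smul z K _ h1 => rw [Matrix.conjTranspose_smul, Matrix.smul_mul, Matrix.trace_smul, h1,
        smul_zero]

/-- The control contributes `δ_{jj'}`, and for `j = j'` the unitaries cancel, leaving `tr D`. No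
condition on the parameters is needed for this inclusion. -/
theorem one_kronecker_mem_hsPerp {D : Matrix (Fin d) (Fin d) ℂ} (hD : D.trace = 0) :
    (1 : Matrix (Fin 2) (Fin 2) ℂ) ⊗ₖ D ∈ hsPerp (controlledChannel N d ψ U).opSpace := by
  rw [mem_hsPerp_controlledChannel]
  intro k j j'
  have hsum : ∀ x x', ∑ c, ∑ c', ψ k j c * star (ψ k j' c') *
      ((1 : Matrix (Fin 2) (Fin 2) ℂ) ⊗ₖ D) (c, x) (c', x') =
      if j' = j then D x x' else 0 := by
    intro x x'
    have h := congrArg (· * D x x') (sum_star_basis_mul_basis (ψ := ψ) k j' j)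
    simp only [Finset.sum_mul] at h
    rw [ite_mul, one_mul, zero_mul] at h
    rw [← h]
    simp [Matrix.one_apply, mul_comm]
  simp only [controlledPairing, hsum]
  by_cases hj : j' = j
  · subst hj
    rw [conditionalUnitary_star_mul_self]
    simpa [Matrix.one_apply, Matrix.trace, apply_ite] using hD
  · simp [hj]

/-- The real Pauli matrices `1, X, Z, XZ`. -/
noncomputable def realPauli : Fin 4 → Matrix.unitaryGroup (Fin 2) ℂ :=
  ![1, ⟨!![0, 1; 1, 0], by
      rw [Matrix.mem_unitaryGroup_iff]
      ext i j
      fin_cases i <;> fin_cases j <;> simp [Matrix.mul_apply, Matrix.star_apply]⟩,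
    ⟨!![1, 0; 0, -1], by
      rw [Matrix.mem_unitaryGroup_iff]
      ext i j
      fin_cases i <;> fin_cases j <;> simp [Matrix.mul_apply, Matrix.star_apply]⟩,
    ⟨!![0, -1; 1, 0], by
      rw [Matrix.mem_unitaryGroup_iff]
      ext i j
      fin_cases i <;> fin_cases j <;> simp [Matrix.mul_apply, Matrix.star_apply]⟩]

/-- Reality makes the conditions with the adjoint of `U k` the same, up to transposition, as those
with `U k`. -/
theorem star_realPauli (u : Fin 4) (x x' : Fin 2) :
    star ((realPauli u : Matrix (Fin 2) (Fin 2) ℂ) x x') =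
      (realPauli u : Matrix (Fin 2) (Fin 2) ℂ) x x' := by
  fin_cases u <;> fin_cases x <;> fin_cases x' <;> simp [realPauli]

theorem eq_zero_of_realPauli {B : Fin 2 → Fin 2 → ℂ}
    (h : ∀ u, ∑ x, ∑ x', star ((realPauli u : Matrix (Fin 2) (Fin 2) ℂ) x x') * B x x' = 0)
    (x x' : Fin 2) : B x x' = 0 := by
  have h0 := h 0
  have h1 := h 1
  have h2 := h 2
  have h3 := h 3
  simp [realPauli] at h0 h1 h2 h3
  fin_cases x <;> fin_cases x' <;> simp
  · linear_combination (h0 + h2) / 2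
  · linear_combination (h1 - h3) / 2
  · linear_combination (h1 + h3) / 2
  · linear_combination (h0 - h2) / 2

theorem exists_hadamardBasis : ∃ e : OrthonormalBasis (Fin 2) ℂ (EuclideanSpace ℂ (Fin 2)),
    ∀ j c, e j c = ((√2 : ℝ) : ℂ)⁻¹ * phaseSign j c := by
  have hs : (((√2 : ℝ) : ℂ)⁻¹) ^ 2 = 1 / 2 := by
    rw [inv_pow, ← Complex.ofReal_pow]
    simp
  let v : Fin 2 → EuclideanSpace ℂ (Fin 2) := fun j =>
    WithLp.toLp 2 fun c => ((√2 : ℝ) : ℂ)⁻¹ * phaseSign j c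
  have hv : Orthonormal ℂ v := by
    rw [orthonormal_iff_ite]
    intro i j
    rw [PiLp.inner_apply]
    fin_cases i <;> fin_cases j <;> simp [v, phaseSign, abs_of_nonneg (Real.sqrt_nonneg 2)] <;> linear_combination 2 * hs
  have hspan : ⊤ ≤ Submodule.span ℂ (Set.range v) := by
    have := (basisOfOrthonormalOfCardEqFinrank hv (by simp)).span_eq
    rw [coe_basisOfOrthonormalOfCardEqFinrank] at this
    exact this.ge
  exact ⟨OrthonormalBasis.mk hv hspan, fun j c => by rw [OrthonormalBasis.coe_mk]⟩

theorem exists_controlledChannel_hsPerp : ∃ (N : ℕ) (_ : NeZero N)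
    (ψ : Fin N → OrthonormalBasis (Fin 2) ℂ (EuclideanSpace ℂ (Fin 2)))
    (U : Fin N → Matrix.unitaryGroup (Fin 2) ℂ),
    hsPerp (controlledChannel N 2 ψ U).opSpace =
      {M | ∃ D : Matrix (Fin 2) (Fin 2) ℂ, D.trace = 0 ∧
        M = (1 : Matrix (Fin 2) (Fin 2) ℂ) ⊗ₖ D} := by
  obtain ⟨e, he⟩ := exists_hadamardBasis
  let f : Fin 2 → OrthonormalBasis (Fin 2) ℂ (EuclideanSpace ℂ (Fin 2)) :=
    ![EuclideanSpace.basisFun (Fin 2) ℂ, e]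
  let κ : Fin 2 × Fin 4 ≃ Fin 8 := finProdFinEquiv
  let ψ : Fin 8 → OrthonormalBasis (Fin 2) ℂ (EuclideanSpace ℂ (Fin 2)) := fun k => f (κ.symm k).1
  let U : Fin 8 → Matrix.unitaryGroup (Fin 2) ℂ := fun k => realPauli (κ.symm k).2
  -- Two bases times four unitaries. The unitaries span all matrices, so the off-diagonal control
  -- blocks of `M` vanish in both bases, which forces `M = 1 ⊗ D`.
  refine ⟨8, inferInstance, ψ, U, Set.Subset.antisymm (fun M hM => ?_) ?_⟩
  · rw [mem_hsPerp_controlledChannel] at hM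
    have h01 : ∀ i x x', ∑ c, ∑ c', f i 0 c * star (f i 1 c') * M (c, x) (c', x') = 0 := by
      intro i
      refine eq_zero_of_realPauli fun u => ?_
      have := hM (κ (i, u)) 0 1
      simpa only [controlledPairing, conditionalUnitary, ψ, U, Equiv.symm_apply_apply, if_true,
        one_ne_zero, if_false, Matrix.conjTranspose_one, Matrix.one_mul] using this
    have h10 : ∀ i x x', ∑ c, ∑ c', f i 1 c * star (f i 0 c') * M (c, x) (c', x') = 0 := by
      intro i x x'
      refine eq_zero_of_realPauli
        (B := fun x' x => ∑ c, ∑ c', f i 1 c * star (f i 0 c') * M (c, x) (c', x')) (fun u => ?_) x' x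
      have := hM (κ (i, u)) 1 0
      simp only [controlledPairing, conditionalUnitary, ψ, U, Equiv.symm_apply_apply, if_true,
        one_ne_zero, if_false, Matrix.mul_one, Matrix.conjTranspose_apply, star_star] at this
      rw [Finset.sum_comm] at this
      simpa only [star_realPauli] using this
    have h00 := hM (κ (0, 0)) 0 0
    have hblock01 : ∀ x x', M (0, x) (1, x') = 0 := fun x x' => by
      simpa [f] using h01 0 x x'
    have hblock10 : ∀ x x', M (1, x) (0, x') = 0 := fun x x' => by
      simpa [f] using h10 0 x x'
    have hs : ((√2 : ℝ) : ℂ) ≠ 0 := by simp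
    -- In the Hadamard basis the off-diagonal block is half the difference of the diagonal blocks,
    -- once the standard off-diagonal blocks vanish.
    have hblock : ∀ x x', M (0, x) (0, x') = M (1, x) (1, x') := fun x x' => by
      have := h01 1 x x'
      simp [f, he, phaseSign, hblock01, hblock10] at this
      field_simp at this
      linear_combination this
    refine ⟨Matrix.of fun x x' => M (0, x) (0, x'), ?_, ?_⟩
    · simp [controlledPairing, conditionalUnitary, ψ, f] at h00
      simpa [Matrix.trace] using h00
    · ext ⟨c, x⟩ ⟨c', x'⟩
      fin_cases c <;> fin_cases c' <;> simp [hblock01, hblock10, hblock]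
  · rintro M ⟨D, hD, rfl⟩
    exact one_kronecker_mem_hsPerp hD

end ControlledChannelComplement

theorem theorem4 :
    (∃ E : QChannel (Fin 2) (Fin 2 × Fin 4),
      E.opSpace = Submodule.span ℂ {1, pauliX, pauliY} ∧
      zeroErrorC E = 0 ∧
      ((1 / 3 : ℝ) : EReal) ≤ zeroErrorCcfb E ∧
      ((1 / 8 : ℝ) : EReal) ≤ zeroErrorQcfb E) ∧
    (∃ (N : ℕ) (_ : NeZero N)
      (ψ : Fin N → OrthonormalBasis (Fin 2) ℂ (EuclideanSpace ℂ (Fin 2)))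
      (U : Fin N → Matrix.unitaryGroup (Fin 2) ℂ),
      hsPerp (controlledChannel N 2 ψ U).opSpace =
        {M | ∃ D : Matrix (Fin 2) (Fin 2) ℂ, D.trace = 0 ∧
          M = (1 : Matrix (Fin 2) (Fin 2) ℂ) ⊗ₖ D}) ∧
    (∀ (N : ℕ) [NeZero N]
      (ψ : Fin N → OrthonormalBasis (Fin 2) ℂ (EuclideanSpace ℂ (Fin 2)))
      (U : Fin N → Matrix.unitaryGroup (Fin 2) ℂ),
      hsPerp (controlledChannel N 2 ψ U).opSpace =
        {M | ∃ D : Matrix (Fin 2) (Fin 2) ℂ, D.trace = 0 ∧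
          M = (1 : Matrix (Fin 2) (Fin 2) ℂ) ⊗ₖ D} →
      zeroErrorC (controlledChannel N 2 ψ U) = 0 ∧
      ((1 / 2 : ℝ) : EReal) ≤ zeroErrorQcfb (controlledChannel N 2 ψ U) ∧
      zeroErrorQcfb (controlledChannel N 2 ψ U) ≤ zeroErrorCcfb (controlledChannel N 2 ψ U)) := by
  refine ⟨exists_channel_opSpace_eq_span_pauli, exists_controlledChannel_hsPerp,
    fun N _ ψ U h => ⟨zeroErrorC_eq_zero_of_hsPerp _ h.subset, ?_,
      zeroErrorQcfb_le_zeroErrorCcfb _⟩⟩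
  simpa using le_zeroErrorQcfb (by norm_num) (controlledChannel_cfbSendsQuantum ψ U)
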